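/- Let $P$ be a geodesic pair of pants, that is, a complete hyperbolic surface homeomorphic to a sphere minus three disks whose boundary components $\alpha,\alpha_1,\alpha_2$ are closed geodesics or punctures, where $\alpha$ is a closed geodesic (each of $\alpha_1,\alpha_2$ may be a puncture). Equivalently, $P$ is the double of a right-angled hyperbolic hexagon along three alternate sides (the seams), where the two sides of the hexagon that come from $\alpha_1$ and $\alpha_2$ may degenerate to ideal vertices. The seams are $\gamma$ from $\alpha$ to $\alpha_1$, $\delta$ from $\alpha$ to $\alpha_2$, and a third one from $\alpha_1$ to $\alpha_2$; they are the simple orthogeodesics between distinct boundary components. Denote hyperbolic lengths by $\ell(\cdot)$, so that $\ell(\gamma)\in(0,\infty]$, with $\ell(\gamma)=\infty$ if and only if $\alpha_1$ is a puncture; put $\tanh\infty=1$. Let $b$ be the endpoint of $\gamma$ on $\alpha_1$ (an ideal point if $\alpha_1$ is a puncture). In each of the two hexagons draw the perpendicular from $b$ to $\delta$; the union of the two perpendiculars is a geodesic loop $\beta$ (a bi-infinite geodesic if $\alpha_1$ is a puncture). The nonstandard half-collar $R_{\alpha,\gamma}$ is the annular region of $P$ between $\alpha$ and $\beta$, and $\eta$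 is the segment of $\delta$ from $\alpha$ to $\beta$. Let $\lambda(R_{\alpha,\gamma})=1/\operatorname{mod}\Gamma$ be the extremal distance between the boundary components of $R_{\alpha,\gamma}$, where $\Gamma$ is the family of rectifiable curves in $R_{\alpha,\gamma}$ joining $\alpha$ to $\beta$, and $\operatorname{mod}\Gamma$ is the infimum of $\iint\rho^2\,dx\,dy$ over all non-negative Borel conformal metrics $\rho\,|dz|$ on $P$ with $\int_c\rho\,|dz|\ge 1$ for every $c\in\Gamma$. **Theorem.** There is a universal constant $C\ge 1$ such that for all $P$, $\alpha$, $\alpha_1$ as above with $\ell(\alpha)>1$, $$\tanh \ell(\eta)=\frac{\tanh\ell(\gamma)}{\cosh(\ell(\alpha)/2)},\qquad C^{-1}\,\ell(\eta)\le \lambda(R_{\alpha,\gamma})\le C\,\ell(\eta).$$ Moreover, if $\ell(\gamma)\ge 1$ (including $\ell(\gamma)=\infty$), then $$C^{-1}e^{-\ell(\alpha)/2}\le\lambda(R_{\alpha,\gamma})\le C\,e^{-\ell(\alpha)/2},$$ and if $\ell(\gamma)<1$, then $$C^{-1}\,\ell(\gamma)\,e^{-\ell(\alpha)/2}\le\lambda(R_{\alpha,\gamma})\le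 C\,\ell(\gamma)\,e^{-\ell(\alpha)/2}.$$ -/

import Mathlib

open scoped ENNReal NNReal UpperHalfPlane
open MeasureTheory

noncomputable section

namespace HalfCollar

/-! ## Geodesics of the upper half-plane

The hyperbolic plane is Mathlib's `ℍ`, with its hyperbolic distance, its topology and its area
measure `dx dy / y ^ 2`. -/

/-- The coefficients of `A |z|² + B Re z + C`.  If `B² - 4 A C > 0`, the zero set in `ℍ` is a
complete geodesic (a half-circle centred on the real axis, or a vertical half-line), and every
complete geodesic is of this kind; the sets where the form is `≥ 0` and `≤ 0` are its two closed
half-planes.  If `B² - 4 A C = 0`, the zero set is a single ideal point. -/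
structure GeodesicForm where
  A : ℝ
  B : ℝ
  C : ℝ

namespace GeodesicForm

/-- Value of the form at a point of `ℂ` (so also at an ideal boundary point). -/
def eval (L : GeodesicForm) (z : ℂ) : ℝ := L.A * Complex.normSq z + L.B * z.re + L.C

/-- The discriminant; the form defines a genuine geodesic iff this is positive. -/
def disc (L : GeodesicForm) : ℝ := L.B ^ 2 - 4 * L.A * L.C

/-- Orthogonality of two geodesics (two half-circles centred on the real axis, with centres `x, x'`
and radii `r, r'`, meet at a right angle iff `(x - x')² = r² + r'²`; in terms of the coefficients
this is the following condition, which also covers the vertical half-lines). -/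
def Orthogonal (L M : GeodesicForm) : Prop := L.B * M.B = 2 * (L.A * M.C + L.C * M.A)

end GeodesicForm

/-! ## Right-angled hexagons and geodesic pairs of pants

A geodesic pair of pants `P` with boundary components `α` (a closed geodesic), `α₁`, `α₂` (each a
closed geodesic or a puncture) is the double of a right-angled hexagon whose sides are, in cyclic
order, half of `α`, the seam `γ` (from `α` to `α₁`), half of `α₁`, the seam `ε` (from `α₁` to `α₂`),
half of `α₂`, the seam `δ` (from `α₂` to `α`); the double is taken along the three seams, which are
the simple orthogeodesics of `P`.  If `α₁` (or `α₂`) is a puncture, the corresponding side is an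
ideal vertex.  By an isometry of `ℍ` the half of `α` is put on the imaginary axis, running from `i`
to `i exp a` with `a = ℓ(α) / 2`, with the hexagon on its right, `γ` issuing from `i exp a` and `δ`
from `i`. Then `γ` lies on `|z| = exp a`, `δ` lies on `|z| = 1`, and `ε` lies on a geodesic with
endpoints `p < q` in `[1, exp a]`; these three numbers are arbitrary.  `α₁` is a puncture iff
`q = exp a`, and `α₂` is a puncture iff `p = 1`. -/
structure Hexagon where
  /-- half of the length of `α` -/
  a : ℝ
  /-- the endpoints of the geodesic carrying the seam `ε` -/
  p : ℝ
  q : ℝ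
  a_pos : 0 < a
  one_le_p : 1 ≤ p
  p_lt_q : p < q
  q_le : q ≤ Real.exp a

namespace Hexagon

variable (H : Hexagon)

/-- The geodesic `Re z = 0` carrying half of `α`. -/
def alphaLine : GeodesicForm := ⟨0, 1, 0⟩

/-- The geodesic `|z| = exp a` carrying the seam `γ`. -/
def gammaLine : GeodesicForm := ⟨-1, 0, Real.exp H.a ^ 2⟩

/-- The geodesic `|z| = 1` carrying the seam `δ`. -/
def deltaLine : GeodesicForm := ⟨1, 0, -1⟩

/-- The geodesic with endpoints `p` and `q`, carrying the seam `ε`. -/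
def epsilonLine : GeodesicForm := ⟨1, -(H.p + H.q), H.p * H.q⟩

/-- The centre of the half-circle carrying half of `α₁`. -/
def alphaOneCentre : ℝ := (H.p * H.q + Real.exp H.a ^ 2) / (H.p + H.q)

/-- The centre of the half-circle carrying half of `α₂`. -/
def alphaTwoCentre : ℝ := (H.p * H.q + 1) / (H.p + H.q)

/-- The common perpendicular of `gammaLine` and `epsilonLine`, carrying half of `α₁` (degenerate to
the common ideal endpoint `exp a` of those two geodesics when `q = exp a`). -/
def alphaOneLine : GeodesicForm := ⟨1, -2 * H.alphaOneCentre, Real.exp H.a ^ 2⟩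

/-- The common perpendicular of `deltaLine` and `epsilonLine`, carrying half of `α₂` (degenerate to
the common ideal endpoint `1` of those two geodesics when `p = 1`). -/
def alphaTwoLine : GeodesicForm := ⟨1, -2 * H.alphaTwoCentre, 1⟩

lemma p_pos : 0 < H.p := lt_of_lt_of_le one_pos H.one_le_p

lemma q_pos : 0 < H.q := H.p_pos.trans H.p_lt_q

lemma alphaOneCentre_pos : 0 < H.alphaOneCentre := by
  have h1 := H.p_pos
  have h2 := H.q_pos
  unfold alphaOneCentre
  positivity

lemma alphaLine_orthogonal_gammaLine : alphaLine.Orthogonal H.gammaLine := by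
  simp [GeodesicForm.Orthogonal, alphaLine, gammaLine]

lemma gammaLine_orthogonal_alphaOneLine : H.gammaLine.Orthogonal H.alphaOneLine := by
  simp only [GeodesicForm.Orthogonal, gammaLine, alphaOneLine]
  ring

lemma alphaOneLine_orthogonal_epsilonLine : H.alphaOneLine.Orthogonal H.epsilonLine := by
  have h : H.p + H.q ≠ 0 := (add_pos H.p_pos H.q_pos).ne'
  simp only [GeodesicForm.Orthogonal, epsilonLine, alphaOneLine, alphaOneCentre]
  field_simp

lemma epsilonLine_orthogonal_alphaTwoLine : H.epsilonLine.Orthogonal H.alphaTwoLine := by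
  have h : H.p + H.q ≠ 0 := (add_pos H.p_pos H.q_pos).ne'
  simp only [GeodesicForm.Orthogonal, epsilonLine, alphaTwoLine, alphaTwoCentre]
  field_simp
  ring

lemma alphaTwoLine_orthogonal_deltaLine : H.alphaTwoLine.Orthogonal deltaLine := by
  simp [GeodesicForm.Orthogonal, deltaLine, alphaTwoLine]

lemma deltaLine_orthogonal_alphaLine : deltaLine.Orthogonal alphaLine := by
  simp [GeodesicForm.Orthogonal, deltaLine, alphaLine]

lemma disc_alphaOneLine : H.alphaOneLine.disc =
    4 * ((Real.exp H.a ^ 2 - H.p ^ 2) * (Real.exp H.a ^ 2 - H.q ^ 2)) / (H.p + H.q) ^ 2 := by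
  have h : H.p + H.q ≠ 0 := (add_pos H.p_pos H.q_pos).ne'
  simp only [GeodesicForm.disc, alphaOneLine, alphaOneCentre]
  field_simp
  ring

lemma disc_alphaTwoLine : H.alphaTwoLine.disc =
    4 * ((H.p ^ 2 - 1) * (H.q ^ 2 - 1)) / (H.p + H.q) ^ 2 := by
  have h : H.p + H.q ≠ 0 := (add_pos H.p_pos H.q_pos).ne'
  simp only [GeodesicForm.disc, alphaTwoLine, alphaTwoCentre]
  field_simp
  ring

/-- The closed hexagon: the intersection of the six closed half-planes. -/
def region : Set ℍ :=
  {z | 0 ≤ alphaLine.eval z ∧ 0 ≤ H.gammaLine.eval z ∧ 0 ≤ H.alphaOneLine.eval z ∧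
    0 ≤ H.epsilonLine.eval z ∧ 0 ≤ H.alphaTwoLine.eval z ∧ 0 ≤ deltaLine.eval z}

/-- The three seams `γ, ε, δ`, along which the two copies of the hexagon are glued. -/
def seams : Set ℍ :=
  {z ∈ H.region | H.gammaLine.eval z = 0 ∨ H.epsilonLine.eval z = 0 ∨ deltaLine.eval z = 0}

/-- Gluing two copies of the hexagon along the seams. -/
def gluing : Setoid (Bool × H.region) where
  r x y := x = y ∨ (x.2 = y.2 ∧ (x.2 : ℍ) ∈ H.seams)
  iseqv := by
    refine ⟨fun x => Or.inl rfl, ?_, ?_⟩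
    · rintro x y (rfl | ⟨h, hs⟩)
      · exact Or.inl rfl
      · exact Or.inr ⟨h.symm, h ▸ hs⟩
    · rintro x y z (rfl | ⟨h, hs⟩) (rfl | ⟨h', hs'⟩)
      · exact Or.inl rfl
      · exact Or.inr ⟨h', hs'⟩
      · exact Or.inr ⟨h, hs⟩
      · exact Or.inr ⟨h.trans h', hs⟩

/-- The geodesic pair of pants: the double of the hexagon along its seams.  It carries the quotient
topology and the quotient `σ`-algebra (which is its Borel `σ`-algebra). -/
def Pants : Type := Quotient H.gluing

instance : TopologicalSpace H.Pants := inferInstanceAs (TopologicalSpace (Quotient H.gluing))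

instance : MeasurableSpace H.Pants := inferInstanceAs (MeasurableSpace (Quotient H.gluing))

/-- The inclusion of one of the two hexagons into the pair of pants. -/
def sheet (s : Bool) (z : H.region) : H.Pants := Quotient.mk H.gluing (s, z)

lemma measurable_sheet (s : Bool) : Measurable (H.sheet s) :=
  (measurable_quotient_mk' (s := H.gluing)).comp measurable_prodMk_left

lemma continuous_sheet (s : Bool) : Continuous (H.sheet s) :=
  (continuous_quotient_mk' (s := H.gluing)).comp (by fun_prop)

/-- The folding map: it is the identity on each of the two hexagons.  It preserves the hyperbolic
length of curves. -/
def fold : H.Pants → ℍ :=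
  Quotient.lift (fun x : Bool × H.region => (x.2 : ℍ)) (by
    rintro x y (rfl | ⟨h, -⟩)
    · rfl
    · exact congrArg Subtype.val h)

/-- The hyperbolic area measure of the pair of pants: the sum of the areas of the two hexagons. -/
def area : Measure H.Pants :=
  ∑ s : Bool, ((volume : Measure ℍ).comap (Subtype.val : H.region → ℍ)).map (H.sheet s)

/-! ## Modulus and extremal length of curve families on the pair of pants -/

/-- A rectifiable curve on the pair of pants, parametrized by `[0, 1]` with bounded speed (every
rectifiable curve has such a parametrization, and lengths do not depend on it).  Values outside
`[0, 1]` are irrelevant. -/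
def IsCurve (c : ℝ → H.Pants) : Prop :=
  ContinuousOn c (Set.Icc 0 1) ∧
    ∃ K : ℝ≥0, LipschitzOnWith K (fun t => H.fold (c t)) (Set.Icc 0 1)

/-- The hyperbolic speed `|z'(t)| / Im z(t)` of a curve. -/
def speed (c : ℝ → H.Pants) (t : ℝ) : ℝ :=
  ‖deriv (fun s => (H.fold (c s) : ℂ)) t‖ / (H.fold (c t)).im

/-- The length of a curve in the conformal metric `ρ ds`, `ds` being the hyperbolic metric. -/
def rhoLength (ρ : H.Pants → ℝ≥0∞) (c : ℝ → H.Pants) : ℝ≥0∞ :=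
  ∫⁻ t in Set.Icc (0 : ℝ) 1, ρ (c t) * ENNReal.ofReal (H.speed c t)

/-- The modulus of a family of rectifiable curves: the infimum of the areas `∫ ρ²` of the conformal
metrics `ρ ds`, with `ρ` non-negative and Borel, for which all curves of the family have length
at least one. -/
def modulus (Γ : Set (ℝ → H.Pants)) : ℝ≥0∞ :=
  ⨅ (ρ : H.Pants → ℝ≥0∞) (_ : Measurable ρ) (_ : ∀ c ∈ Γ, 1 ≤ H.rhoLength ρ c),
    ∫⁻ x, ρ x ^ 2 ∂H.area

/-- The extremal length of a curve family. -/
def extremalLength (Γ : Set (ℝ → H.Pants)) : ℝ≥0∞ := (H.modulus Γ)⁻¹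

/-- The rectifiable curves that join `S` to `T` and whose interior runs in `R`. -/
def joiningCurves (R S T : Set H.Pants) : Set (ℝ → H.Pants) :=
  {c | H.IsCurve c ∧ c 0 ∈ S ∧ c 1 ∈ T ∧ ∀ t ∈ Set.Ioo (0 : ℝ) 1, c t ∈ R}

/-! ## The nonstandard half-collar -/

/-- The boundary geodesic `α`. -/
def alpha : Set H.Pants := {x | alphaLine.eval (H.fold x) = 0}

/-- The endpoint of `γ` on `α₁`, i.e. the point where `gammaLine` and `alphaOneLine` meet; it is the
ideal point `exp a` when `α₁` is a puncture. -/
def endpoint : ℂ :=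
  ⟨Real.exp H.a ^ 2 / H.alphaOneCentre,
    √(Real.exp H.a ^ 2 - (Real.exp H.a ^ 2 / H.alphaOneCentre) ^ 2)⟩

/-- The geodesic through (or ending at) `endpoint` and orthogonal to the seam `δ`, oriented so that
the form is positive on the side of `α`. -/
def betaLine : GeodesicForm :=
  ⟨1, -((Complex.normSq H.endpoint + 1) / H.endpoint.re), 1⟩

/-- The geodesic loop `β`: the union, over the two hexagons, of the perpendiculars dropped from the
endpoint of `γ` to the seam `δ`. -/
def beta : Set H.Pants := {x | H.betaLine.eval (H.fold x) = 0}

/-- The nonstandard half-collar `R_{α, γ}`: the part of the pair of pants between `α` and `β`. -/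
def halfCollar : Set H.Pants :=
  {x | 0 < alphaLine.eval (H.fold x) ∧ 0 < H.betaLine.eval (H.fold x)}

/-- The extremal distance `λ(R_{α, γ})` between the boundary components `α` and `β` of the
nonstandard half-collar. -/
def extremalDistance : ℝ≥0∞ := H.extremalLength (H.joiningCurves H.halfCollar H.alpha H.beta)

/-- The foot `i` of `δ` on `α`. -/
def deltaFoot : ℍ := UpperHalfPlane.I

/-- The foot `i exp a` of `γ` on `α`. -/
def gammaFoot : ℍ := ⟨⟨0, Real.exp H.a⟩, Real.exp_pos H.a⟩

/-- The length of a geodesic segment or ray `s` with origin `z₀`. -/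
def lengthFrom (z₀ : ℍ) (s : Set ℍ) : ℝ≥0∞ := ⨆ z ∈ s, edist z₀ z

/-- `ℓ(α)`: `α` is formed by the two copies of the segment from `i` to `i exp a`. -/
def alphaLength : ℝ := 2 * dist deltaFoot H.gammaFoot

/-- `ℓ(γ)`; infinite when `α₁` is a puncture. -/
def gammaLength : ℝ≥0∞ := lengthFrom H.gammaFoot {z ∈ H.region | H.gammaLine.eval z = 0}

/-- `ℓ(η)`, where `η` is the part of the seam `δ` from `α` to `β`. -/
def etaLength : ℝ≥0∞ :=
  lengthFrom deltaFoot {z ∈ H.region | deltaLine.eval z = 0 ∧ 0 ≤ H.betaLine.eval z}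

lemma endpoint_re_pos : 0 < H.endpoint.re :=
  div_pos (pow_pos (Real.exp_pos _) 2) H.alphaOneCentre_pos

lemma exp_le_alphaOneCentre : Real.exp H.a ≤ H.alphaOneCentre := by
  have h := H.q_le
  have h' := H.p_lt_q
  unfold alphaOneCentre
  rw [le_div_iff₀ (add_pos H.p_pos H.q_pos)]
  nlinarith [mul_nonneg (sub_nonneg.2 h) (sub_nonneg.2 (h'.le.trans h))]

lemma normSq_endpoint : Complex.normSq H.endpoint = Real.exp H.a ^ 2 := by
  have h1 := H.exp_le_alphaOneCentre
  have h2 := Real.exp_pos H.a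
  have h3 : Real.exp H.a ^ 2 / H.alphaOneCentre ≤ Real.exp H.a := by
    rw [div_le_iff₀ H.alphaOneCentre_pos]
    nlinarith
  have h4 : 0 ≤ Real.exp H.a ^ 2 / H.alphaOneCentre := H.endpoint_re_pos.le
  have h5 : 0 ≤ Real.exp H.a ^ 2 - (Real.exp H.a ^ 2 / H.alphaOneCentre) ^ 2 := by nlinarith
  rw [endpoint, Complex.normSq_mk, Real.mul_self_sqrt h5]
  ring

lemma gammaLine_eval_endpoint : H.gammaLine.eval H.endpoint = 0 := by
  simp [GeodesicForm.eval, gammaLine, normSq_endpoint]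

lemma alphaOneLine_eval_endpoint : H.alphaOneLine.eval H.endpoint = 0 := by
  have h := H.alphaOneCentre_pos.ne'
  simp only [GeodesicForm.eval, alphaOneLine, normSq_endpoint]
  simp only [endpoint]
  field_simp
  ring

lemma betaLine_eval_endpoint : H.betaLine.eval H.endpoint = 0 := by
  have h := H.endpoint_re_pos.ne'
  simp only [GeodesicForm.eval, betaLine]
  field_simp
  ring

lemma betaLine_orthogonal_deltaLine : H.betaLine.Orthogonal deltaLine := by
  simp [GeodesicForm.Orthogonal, deltaLine, betaLine]

lemma alphaLength_eq : H.alphaLength = 2 * H.a := by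
  have h : dist deltaFoot H.gammaFoot = dist (Real.log deltaFoot.im) (Real.log H.gammaFoot.im) :=
    UpperHalfPlane.dist_of_re_eq (by simp [deltaFoot, gammaFoot, UpperHalfPlane.re])
  have h1 : deltaFoot.im = 1 := by simp [deltaFoot]
  have h2 : H.gammaFoot.im = Real.exp H.a := rfl
  rw [alphaLength, h, h1, h2, Real.log_one, Real.log_exp, Real.dist_eq, zero_sub, abs_neg,
    abs_of_pos H.a_pos]

end Hexagon

/-- The hyperbolic tangent on `[0, ∞]`, with `tanh ∞ = 1`. -/
def extTanh (x : ℝ≥0∞) : ℝ := if x = ∞ then 1 else Real.tanh x.toReal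

/-- `C⁻¹ y ≤ x ≤ C y`. -/
def Comparable (C : ℝ) (x y : ℝ≥0∞) : Prop :=
  ENNReal.ofReal C⁻¹ * y ≤ x ∧ x ≤ ENNReal.ofReal C * y

end HalfCollar

end

namespace HalfCollar

/-! Write `a = ℓ(α)/2`, `T = tanh ℓ(γ)` and `τ = tanh ℓ(η)`. On the geodesic `|z| = R`, the distance
`d` from `iR` satisfies `tanh d = Re z / R`, so both lengths are read off from where the arcs are
cut; this gives `τ = T / cosh a`. In the same coordinates `α` and `β` are the levels `0` and `τ` of
the single function `height z = 2 Re z / (|z|² + 1)`, that is, of `sin u / cosh (log |z|)` with `u`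
the angle to the imaginary axis.

Everything else follows from `λ ≍ τ`, which has two halves.

Upper bound for the modulus (`modulus_le`): the Euclidean gradient of `height` is at most `2 / (|z|²
+ 1)`, so `2 / (τ (|z|² + 1)) |dz|` on the collar is admissible. Its angular width at radius `r` is
`O(τ (r² + 1) / r)`, and the area becomes a multiple of `τ⁻¹ ∫ dr / (1 + r²)`.

Lower bound (`le_modulus`): the circular arcs `|z| = r`, `1 < r < 3/2`, in one hexagon join `α` to
`β` and subtend an angle `O(τ)`. Cauchy–Schwarz on each arc, integrated over `r`, bounds the area of
any admissible metric below by a multiple of `1 / τ`. The hypothesis `ℓ(α) > 1` provides this range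
of radii. That these arcs stay in the hexagon is `mem_region_of_le`.

Finally `τ` is compared with `ℓ(η)`, and with `T exp (-a)`; here `T` is comparable to `1` when `ℓ(γ)
≥ 1` and to `ℓ(γ)` when `ℓ(γ) < 1`. -/

/-! ### Lengths along circles centred at the origin. -/

lemma tanh_dist_of_normSq_eq {R : ℝ} (hR : 0 < R) {z₀ z : ℍ} (h₀ : (z₀ : ℂ) = ⟨0, R⟩)
    (hz : Complex.normSq z = R ^ 2) (hre : 0 ≤ z.re) : Real.tanh (dist z₀ z) = z.re / R := by
  have hy := z.im_pos
  have hre0 : z₀.re = 0 := congrArg Complex.re h₀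
  have him0 : z₀.im = R := congrArg Complex.im h₀
  have hxy : z.re ^ 2 + z.im ^ 2 = R ^ 2 := by
    rw [← hz, Complex.normSq_apply]; simp [sq]
  have hc : Real.cosh (dist z₀ z) = R / z.im := by
    rw [UpperHalfPlane.cosh_dist', hre0, him0]
    field_simp
    linarith
  have hs : Real.sinh (dist z₀ z) = z.re / z.im := by
    have h1 := Real.cosh_sq (dist z₀ z)
    have h2 : Real.sinh (dist z₀ z) ^ 2 = (z.re / z.im) ^ 2 := by
      have h3 : Real.sinh (dist z₀ z) ^ 2 = (R / z.im) ^ 2 - 1 := by rw [← hc]; linarith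
      rw [h3]
      field_simp
      linarith
    exact (pow_left_inj₀ (Real.sinh_nonneg_iff.2 dist_nonneg) (div_nonneg hre hy.le)
      two_ne_zero).1 h2
  rw [Real.tanh_eq_sinh_div_cosh, hs, hc]
  field_simp

lemma dist_of_normSq_eq {R : ℝ} (hR : 0 < R) {z₀ z : ℍ} (h₀ : (z₀ : ℂ) = ⟨0, R⟩)
    (hz : Complex.normSq z = R ^ 2) (hre : 0 ≤ z.re) : dist z₀ z = Real.artanh (z.re / R) := by
  rw [← tanh_dist_of_normSq_eq hR h₀ hz hre, Real.artanh_tanh]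

lemma exists_normSq_eq_re_eq {R x : ℝ} (hx0 : 0 ≤ x) (hx : x < R) :
    ∃ z : ℍ, Complex.normSq z = R ^ 2 ∧ z.re = x := by
  have h : 0 < R ^ 2 - x ^ 2 := by nlinarith
  refine ⟨⟨⟨x, √(R ^ 2 - x ^ 2)⟩, Real.sqrt_pos.2 h⟩, ?_, rfl⟩
  rw [Complex.normSq_mk, Real.mul_self_sqrt h.le]
  ring

/-- The length of the arc of `|z| = R` that issues from `R i` and on which `Re z ≤ T R`. -/
lemma lengthFrom_arc {R T : ℝ} (hR : 0 < R) (hT : 0 < T) (hT1 : T ≤ 1) {z₀ : ℍ}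
    (h₀ : (z₀ : ℂ) = ⟨0, R⟩) {s : Set ℍ}
    (hs : ∀ z : ℍ, z ∈ s ↔ Complex.normSq z = R ^ 2 ∧ 0 ≤ z.re ∧ z.re ≤ T * R) :
    Hexagon.lengthFrom z₀ s = if T < 1 then ENNReal.ofReal (Real.artanh T) else ∞ := by
  unfold Hexagon.lengthFrom
  split_ifs with h
  · apply le_antisymm
    · refine iSup₂_le fun z hz => ?_
      obtain ⟨h1, h2, h3⟩ := (hs z).1 hz
      rw [edist_dist, dist_of_normSq_eq hR h₀ h1 h2]
      apply ENNReal.ofReal_le_ofReal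
      refine Real.artanh_le_artanh ?_ h ((div_le_iff₀ hR).2 h3)
      have := div_nonneg h2 hR.le
      linarith
    · obtain ⟨z, h1, h2⟩ := exists_normSq_eq_re_eq (R := R) (x := T * R) (by positivity)
        (by nlinarith)
      have hz : z ∈ s := (hs z).2 ⟨h1, by rw [h2]; positivity, h2.le⟩
      refine le_trans (le_of_eq ?_) (le_iSup₂ (f := fun z _ => edist z₀ z) z hz)
      rw [edist_dist, dist_of_normSq_eq hR h₀ h1 (by rw [h2]; positivity), h2,
        mul_div_cancel_right₀ _ hR.ne']
  · have hT' : T = 1 := le_antisymm hT1 (not_lt.1 h)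
    subst hT'
    -- The arc reaches its ideal endpoint: it contains a point at every distance `d`, namely the one
    -- with `Re z = R tanh d < R`.
    refine ENNReal.eq_top_of_forall_nnreal_le fun d => ?_
    have hd : 0 ≤ Real.tanh d := by
      rw [Real.tanh_eq_sinh_div_cosh]
      exact div_nonneg (Real.sinh_nonneg_iff.2 d.2) (Real.cosh_pos _).le
    have hd1 := Real.tanh_lt_one d
    obtain ⟨z, h1, h2⟩ := exists_normSq_eq_re_eq (R := R) (x := Real.tanh d * R) (by positivity)
      (by nlinarith)
    have hz : z ∈ s := (hs z).2 ⟨h1, by rw [h2]; positivity, by rw [h2]; nlinarith⟩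
    refine le_trans (le_of_eq ?_) (le_iSup₂ (f := fun z _ => edist z₀ z) z hz)
    rw [edist_dist, dist_of_normSq_eq hR h₀ h1 (by rw [h2]; positivity), h2,
      mul_div_cancel_right₀ _ hR.ne', Real.artanh_tanh]
    simp

/-! ### The hexagon, the geodesic `β` and the lengths of `γ` and `η`. -/

namespace Hexagon

variable (H : Hexagon)

/-- The hyperbolic tangent of `ℓ(γ)`. -/
noncomputable def gammaTanh : ℝ := Real.exp H.a / H.alphaOneCentre

/-- The hyperbolic tangent of `ℓ(η)`. -/
noncomputable def etaTanh : ℝ := H.gammaTanh / Real.cosh H.a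

lemma gammaTanh_pos : 0 < H.gammaTanh := div_pos (Real.exp_pos _) H.alphaOneCentre_pos

lemma gammaTanh_le_one : H.gammaTanh ≤ 1 :=
  (div_le_one H.alphaOneCentre_pos).2 H.exp_le_alphaOneCentre

lemma etaTanh_pos : 0 < H.etaTanh := div_pos H.gammaTanh_pos (Real.cosh_pos _)

lemma etaTanh_lt_one : H.etaTanh < 1 := by
  rw [etaTanh, div_lt_one (Real.cosh_pos _)]
  exact H.gammaTanh_le_one.trans_lt (Real.one_lt_cosh.2 H.a_pos.ne')

lemma one_lt_exp : 1 < Real.exp H.a := Real.one_lt_exp_iff.2 H.a_pos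

lemma etaTanh_eq : H.etaTanh =
    2 * Real.exp H.a ^ 2 * (H.p + H.q) /
      ((H.p * H.q + Real.exp H.a ^ 2) * (Real.exp H.a ^ 2 + 1)) := by
  have h1 := H.p_pos
  have h2 := H.q_pos
  have h3 := Real.exp_pos H.a
  rw [etaTanh, gammaTanh, alphaOneCentre, Real.cosh_eq, Real.exp_neg]
  field_simp

lemma etaTanh_mul_exp : H.etaTanh * (Real.exp H.a ^ 2 + 1) = 2 * (H.gammaTanh * Real.exp H.a) := by
  have h3 := Real.exp_pos H.a
  rw [etaTanh, Real.cosh_eq, Real.exp_neg]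
  field_simp

/-- This identifies `β` as a level set: the form vanishes exactly where `2 Re z / (|z|² + 1) =
etaTanh`. -/
lemma betaLine_eval (z : ℂ) :
    H.betaLine.eval z = Complex.normSq z + 1 - 2 * z.re / H.etaTanh := by
  have h1 := H.p_pos
  have h2 := H.q_pos
  have h3 := Real.exp_pos H.a
  simp only [GeodesicForm.eval, betaLine, normSq_endpoint]
  rw [etaTanh_eq, endpoint, alphaOneCentre]
  field_simp
  ring

lemma betaLine_eval_nonneg_iff (z : ℂ) :
    0 ≤ H.betaLine.eval z ↔ 2 * z.re ≤ H.etaTanh * (Complex.normSq z + 1) := by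
  rw [betaLine_eval, sub_nonneg, div_le_iff₀ H.etaTanh_pos, mul_comm H.etaTanh]

lemma betaLine_eval_pos_iff (z : ℂ) :
    0 < H.betaLine.eval z ↔ 2 * z.re < H.etaTanh * (Complex.normSq z + 1) := by
  rw [betaLine_eval, sub_pos, div_lt_iff₀ H.etaTanh_pos, mul_comm H.etaTanh]

lemma betaLine_eval_eq_zero_iff (z : ℂ) :
    H.betaLine.eval z = 0 ↔ 2 * z.re = H.etaTanh * (Complex.normSq z + 1) := by
  rw [betaLine_eval, sub_eq_zero, eq_comm, div_eq_iff H.etaTanh_pos.ne', mul_comm H.etaTanh]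

/-- The part of the annulus `1 ≤ |z| ≤ exp a` between `α` and `β` lies in the hexagon. -/
lemma mem_region_of_le {z : ℍ} (h0 : 0 ≤ z.re) (h1 : 1 ≤ Complex.normSq z)
    (hE : Complex.normSq z ≤ Real.exp H.a ^ 2)
    (hβ : 2 * z.re ≤ H.etaTanh * (Complex.normSq z + 1)) : z ∈ H.region := by
  have hp := H.p_pos
  have hq := H.q_pos
  have hp1 := H.one_le_p
  have hpq := H.p_lt_q
  have hqE := H.q_le
  have hE1 := H.one_lt_exp
  have hE0 := Real.exp_pos H.a
  rw [etaTanh_eq] at hβ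
  simp only [region, Set.mem_ofPred_eq, GeodesicForm.eval, alphaLine, gammaLine, alphaOneLine,
    epsilonLine, alphaTwoLine, deltaLine, alphaOneCentre, alphaTwoCentre, UpperHalfPlane.coe_re]
  generalize Complex.normSq (z : ℂ) = n at *
  generalize z.re = x at *
  generalize Real.exp H.a = E at *
  generalize H.p = p at *
  generalize H.q = q at *
  have hM : 0 < (p * q + E ^ 2) * (E ^ 2 + 1) := by positivity
  rw [div_mul_eq_mul_div, le_div_iff₀ hM] at hβ
  have hE2 : 0 < E ^ 2 - 1 := by nlinarith
  refine ⟨by linarith, by linarith, ?_, ?_, ?_, by linarith⟩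
  -- Side `α₁`: after inserting the bound on `x`, what remains is `2 E² (n + 1) ≤ (n + E²) (E² +
  -- 1)`, whose defect is `(E² - 1) (E² - n)`.
  · have key : (p * q + E ^ 2) * (2 * x) ≤ (n + E ^ 2) * (p + q) := by
      refine le_of_mul_le_mul_right (a := E ^ 2 + 1) ?_ (by positivity)
      have : 0 ≤ (E ^ 2 - 1) * (E ^ 2 - n) * (p + q) :=
        mul_nonneg (mul_nonneg hE2.le (by linarith)) (by linarith)
      nlinarith
    have h2 : 0 ≤ ((n + E ^ 2) * (p + q) - (p * q + E ^ 2) * (2 * x)) / (p + q) :=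
      div_nonneg (by linarith) (by linarith)
    refine h2.trans (le_of_eq ?_)
    field_simp
    ring
  -- Side `ε`: with the bound on `x` inserted, both sides are affine in `n ∈ [1, E²]`, so it
  -- suffices to check the two ends. `keyE` is the case `n = E²`, `key1` the case `n = 1`, and `c2`,
  -- `c3` interpolate with weights `n - 1` and `E² - n`.
  · have a1 : 0 ≤ (E - p) * (E - q) := mul_nonneg (by linarith) (by linarith)
    have a2 : 0 ≤ (p - 1) * (q - 1) := mul_nonneg (by linarith) (by linarith)
    have keyE : (p + q) * (p + q) * E ^ 2 ≤ (p * q + E ^ 2) * (p * q + E ^ 2) := by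
      have : (p + q) * E ≤ p * q + E ^ 2 := by nlinarith
      have := mul_le_mul this this (by positivity) (by positivity)
      nlinarith
    have key1 : (p + q) * (p + q) * (2 * E ^ 2) ≤
        (p * q + 1) * ((p * q + E ^ 2) * (E ^ 2 + 1)) := by
      have b1 : (p + q) * E ≤ p * q + E ^ 2 := by nlinarith
      have b2 : 2 * E ≤ E ^ 2 + 1 := by nlinarith [sq_nonneg (E - 1)]
      have b3 : p + q ≤ p * q + 1 := by nlinarith
      have b4 := mul_le_mul b3 (mul_le_mul b1 b2 (by positivity) (by positivity))
        (by positivity) (by positivity)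
      nlinarith
    have key : (p + q) * (2 * x) ≤ 2 * (n + p * q) := by
      refine le_of_mul_le_mul_right (a := (p * q + E ^ 2) * (E ^ 2 + 1)) ?_ hM
      have c1 : (p + q) * (2 * x) * ((p * q + E ^ 2) * (E ^ 2 + 1)) ≤
          (p + q) * (2 * E ^ 2 * (p + q) * (n + 1)) := by
        have := mul_le_mul_of_nonneg_left hβ (by positivity : 0 ≤ p + q)
        nlinarith
      refine c1.trans (le_of_mul_le_mul_right (a := E ^ 2 - 1) ?_ hE2)
      have c2 := mul_le_mul_of_nonneg_left keyE
        (mul_nonneg (sub_nonneg.2 h1) (by positivity : 0 ≤ 2 * (E ^ 2 + 1)))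
      have c3 := mul_le_mul_of_nonneg_left key1 (mul_nonneg (sub_nonneg.2 hE) zero_le_two)
      nlinarith
    linarith
  -- Side `α₂`: the defect is now `(E² - 1) (E² - p q)` times positive factors.
  · have key : (p * q + 1) * (2 * x) ≤ (n + 1) * (p + q) := by
      refine le_of_mul_le_mul_right (a := (p * q + E ^ 2) * (E ^ 2 + 1)) ?_ hM
      have c1 := mul_le_mul_of_nonneg_left hβ (by positivity : 0 ≤ p * q + 1)
      have c0 : p * q ≤ E ^ 2 := by nlinarith
      have c2 : 0 ≤ (E ^ 2 - 1) * (E ^ 2 - p * q) * ((n + 1) * (p + q)) :=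
        mul_nonneg (mul_nonneg hE2.le (by linarith)) (mul_nonneg (by linarith) (by linarith))
      nlinarith
    have h2 : 0 ≤ ((n + 1) * (p + q) - (p * q + 1) * (2 * x)) / (p + q) :=
      div_nonneg (by linarith) (by linarith)
    refine h2.trans (le_of_eq ?_)
    field_simp
    ring

lemma re_nonneg_of_mem_region {z : ℍ} (hz : z ∈ H.region) : 0 ≤ z.re := by
  have := hz.1
  simpa [GeodesicForm.eval, alphaLine] using this

lemma gammaLength_eq : H.gammaLength =
    if H.gammaTanh < 1 then ENNReal.ofReal (Real.artanh H.gammaTanh) else ∞ := by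
  have hc := H.alphaOneCentre_pos
  refine lengthFrom_arc (Real.exp_pos H.a) H.gammaTanh_pos H.gammaTanh_le_one rfl fun z => ?_
  have hn : H.gammaLine.eval z = 0 ↔ Complex.normSq z = Real.exp H.a ^ 2 := by
    simp only [GeodesicForm.eval, gammaLine]
    constructor <;> intro h <;> linarith
  simp only [Set.mem_ofPred_eq, hn]
  constructor
  · rintro ⟨hz, h⟩
    refine ⟨h, H.re_nonneg_of_mem_region hz, ?_⟩
    have h2 := hz.2.2.1
    simp only [GeodesicForm.eval, alphaOneLine, h, UpperHalfPlane.coe_re] at h2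
    rw [gammaTanh, div_mul_eq_mul_div, le_div_iff₀ hc]
    linarith
  · rintro ⟨h, h1, h2⟩
    refine ⟨H.mem_region_of_le h1 ?_ h.le ?_, h⟩
    · rw [h]; nlinarith [H.one_lt_exp]
    · rw [h, etaTanh_mul_exp]; linarith

lemma etaLength_eq : H.etaLength = ENNReal.ofReal (Real.artanh H.etaTanh) := by
  rw [etaLength, lengthFrom_arc one_pos H.etaTanh_pos H.etaTanh_lt_one.le rfl,
    if_pos H.etaTanh_lt_one]
  intro z
  have hn : deltaLine.eval z = 0 ↔ Complex.normSq z = 1 ^ 2 := by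
    simp only [GeodesicForm.eval, deltaLine]
    constructor <;> intro h <;> linarith
  simp only [Set.mem_ofPred_eq, hn, betaLine_eval_nonneg_iff]
  constructor
  · rintro ⟨hz, h, hβ⟩
    refine ⟨h, H.re_nonneg_of_mem_region hz, ?_⟩
    rw [h, UpperHalfPlane.coe_re] at hβ
    linarith
  · rintro ⟨h, h1, h2⟩
    have hβ : 2 * (z : ℂ).re ≤ H.etaTanh * (Complex.normSq z + 1) := by
      rw [h, UpperHalfPlane.coe_re]; linarith
    refine ⟨H.mem_region_of_le h1 ?_ ?_ hβ, h, hβ⟩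
    · rw [h]; norm_num
    · rw [h]; nlinarith [H.one_lt_exp]

lemma extTanh_gammaLength : extTanh H.gammaLength = H.gammaTanh := by
  rw [gammaLength_eq, extTanh]
  have h0 := H.gammaTanh_pos
  split_ifs with h1 h2 h3
  · simp at h2
  · rw [ENNReal.toReal_ofReal (Real.artanh_nonneg h0.le), Real.tanh_artanh ⟨by linarith, h1⟩]
  · exact le_antisymm (not_lt.1 h1) H.gammaTanh_le_one
  · exact absurd rfl h3

lemma extTanh_etaLength : extTanh H.etaLength = H.etaTanh := by
  have h0 := H.etaTanh_pos
  rw [etaLength_eq, extTanh, if_neg ENNReal.ofReal_ne_top,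
    ENNReal.toReal_ofReal (Real.artanh_nonneg h0.le),
    Real.tanh_artanh ⟨by linarith, H.etaTanh_lt_one⟩]

end Hexagon

/-! ### Hyperbolic area in polar coordinates. -/

/-- The point of `ℍ` with polar coordinates `p` (meaningful if `0 < p.1` and `0 < p.2 < π`). -/
noncomputable def polarPoint (p : ℝ × ℝ) : ℍ :=
  UpperHalfPlane.ofComplex (Complex.polarCoord.symm p)

lemma measurable_ofComplex : Measurable UpperHalfPlane.ofComplex := by
  have hs : MeasurableSet {w : ℂ | 0 < w.im} := measurableSet_lt measurable_const Complex.measurable_im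
  have h1 : Measurable (fun w : {w : ℂ | 0 < w.im} => UpperHalfPlane.ofComplex (w : ℂ)) := by
    have : Continuous (fun w : {w : ℂ | 0 < w.im} => UpperHalfPlane.ofComplex (w : ℂ)) := by
      rw [UpperHalfPlane.isEmbedding_coe.continuous_iff]
      refine continuous_subtype_val.congr fun w => ?_
      simp [UpperHalfPlane.ofComplex_apply_of_im_pos w.2]
    exact this.measurable
  -- Off the upper half-plane `ofComplex` takes one constant default value.
  have h2 : Measurable (fun w : ({w : ℂ | 0 < w.im}ᶜ : Set ℂ) =>
      UpperHalfPlane.ofComplex (w : ℂ)) := by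
    have : (fun w : ({w : ℂ | 0 < w.im}ᶜ : Set ℂ) => UpperHalfPlane.ofComplex (w : ℂ)) =
        fun _ => UpperHalfPlane.ofComplex 0 := by
      funext w
      rw [UpperHalfPlane.ofComplex_apply_of_im_nonpos (not_lt.1 w.2),
        UpperHalfPlane.ofComplex_apply_of_im_nonpos (by simp)]
    rw [this]
    exact measurable_const
  exact measurable_of_restrict_of_restrict_compl hs h1 h2

lemma measurable_polarPoint : Measurable polarPoint := by
  refine measurable_ofComplex.comp ?_
  have : (Complex.polarCoord.symm : ℝ × ℝ → ℂ) =
      fun p => (p.1 : ℂ) * (Real.cos p.2 + Real.sin p.2 * Complex.I) := by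
    funext p; exact Complex.polarCoord_symm_apply p
  rw [this]
  fun_prop

lemma coe_polarPoint {p : ℝ × ℝ} (h1 : 0 < p.1) (h2 : p.2 ∈ Set.Ioo 0 Real.pi) :
    (polarPoint p : ℂ) = ⟨p.1 * Real.cos p.2, p.1 * Real.sin p.2⟩ := by
  have h : Complex.polarCoord.symm p = ⟨p.1 * Real.cos p.2, p.1 * Real.sin p.2⟩ := by
    rw [Complex.polarCoord_symm_apply]
    apply Complex.ext <;> simp [-Complex.ofReal_cos, -Complex.ofReal_sin]
  rw [polarPoint, h, UpperHalfPlane.ofComplex_apply_of_im_pos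
    (mul_pos h1 (Real.sin_pos_of_mem_Ioo h2))]

lemma polarPoint_re {p : ℝ × ℝ} (h1 : 0 < p.1) (h2 : p.2 ∈ Set.Ioo 0 Real.pi) :
    (polarPoint p).re = p.1 * Real.cos p.2 := congrArg Complex.re (coe_polarPoint h1 h2)

lemma polarPoint_im {p : ℝ × ℝ} (h1 : 0 < p.1) (h2 : p.2 ∈ Set.Ioo 0 Real.pi) :
    (polarPoint p).im = p.1 * Real.sin p.2 := congrArg Complex.im (coe_polarPoint h1 h2)

lemma normSq_polarPoint {p : ℝ × ℝ} (h1 : 0 < p.1) (h2 : p.2 ∈ Set.Ioo 0 Real.pi) :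
    Complex.normSq (polarPoint p) = p.1 ^ 2 := by
  rw [coe_polarPoint h1 h2, Complex.normSq_mk]
  linear_combination p.1 ^ 2 * Real.sin_sq_add_cos_sq p.2

lemma lintegral_eq_lintegral_im_pos {f : ℍ → ℝ≥0∞} (hf : Measurable f) :
    ∫⁻ z, f z = ∫⁻ w in {w : ℂ | 0 < w.im},
      ENNReal.ofReal (1 / w.im ^ 2) * f (UpperHalfPlane.ofComplex w) := by
  have hr : {w : ℂ | 0 < w.im} = Set.range UpperHalfPlane.coe := by
    ext w
    exact ⟨fun h => ⟨⟨w, h⟩, rfl⟩, by rintro ⟨z, rfl⟩; exact z.im_pos⟩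
  have he := UpperHalfPlane.measurableEmbedding_coe
  rw [hr, ← he.map_comap, he.lintegral_map, UpperHalfPlane.volume_def,
    lintegral_withDensity_eq_lintegral_mul _ _ hf]
  · refine lintegral_congr fun z => ?_
    simp only [Pi.mul_apply, UpperHalfPlane.ofComplex_apply]
    congr 1
    rw [ENNReal.ofReal, UpperHalfPlane.coe_im]
    congr 1
    apply NNReal.eq
    rw [Real.coe_toNNReal _ (by positivity)]
    push_cast
    rw [one_div, one_div, inv_pow]
  · refine Measurable.coe_nnreal_ennreal ?_
    refine Measurable.pow_const ?_ _
    refine measurable_const.div ?_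
    exact UpperHalfPlane.continuous_im.measurable.subtype_mk

/-- The hyperbolic area in polar coordinates. -/
lemma lintegral_eq_lintegral_polarPoint {f : ℍ → ℝ≥0∞} (hf : Measurable f) :
    ∫⁻ z, f z = ∫⁻ p in Set.Ioi (0 : ℝ) ×ˢ Set.Ioo (0 : ℝ) Real.pi,
      ENNReal.ofReal (1 / (p.1 * Real.sin p.2 ^ 2)) * f (polarPoint p) := by
  have hs : MeasurableSet {w : ℂ | 0 < w.im} := measurableSet_lt measurable_const Complex.measurable_im
  have hT : MeasurableSet (Set.Ioi (0 : ℝ) ×ˢ Set.Ioo (0 : ℝ) Real.pi) :=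
    measurableSet_Ioi.prod measurableSet_Ioo
  rw [lintegral_eq_lintegral_im_pos hf, ← lintegral_indicator hs,
    ← Complex.lintegral_comp_polarCoord_symm, ← lintegral_indicator hT,
    ← lintegral_indicator polarCoord.open_target.measurableSet]
  refine lintegral_congr fun p => ?_
  by_cases hp : p ∈ Set.Ioi (0 : ℝ) ×ˢ Set.Ioo (0 : ℝ) Real.pi
  · have hp1 : 0 < p.1 := hp.1
    have hsin : 0 < Real.sin p.2 := Real.sin_pos_of_mem_Ioo hp.2
    have hp' : p ∈ polarCoord.target :=
      ⟨hp.1, by have := hp.2.1; have := Real.pi_pos; linarith, hp.2.2⟩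
    have him : (Complex.polarCoord.symm p).im = p.1 * Real.sin p.2 := by
      rw [Complex.polarCoord_symm_apply]
      simp [-Complex.ofReal_cos, -Complex.ofReal_sin]
    rw [Set.indicator_of_mem hp, Set.indicator_of_mem hp', Set.indicator_of_mem, him, smul_eq_mul,
      ← mul_assoc, ← ENNReal.ofReal_mul hp1.le]
    · congr 2
      field_simp
    · change 0 < (Complex.polarCoord.symm p).im
      rw [him]
      positivity
  · rw [Set.indicator_of_notMem hp]
    by_cases hp' : p ∈ polarCoord.target
    · rw [Set.indicator_of_mem hp', Set.indicator_of_notMem, smul_zero]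
      have hp1 : 0 < p.1 := hp'.1
      have hp2 : p.2 ≤ 0 := by
        by_contra h
        exact hp ⟨hp1, not_le.1 h, hp'.2.2⟩
      change ¬ 0 < (Complex.polarCoord.symm p).im
      rw [Complex.polarCoord_symm_apply]
      have : Real.sin p.2 ≤ 0 := Real.sin_nonpos_of_nonpos_of_neg_pi_le hp2 hp'.2.1.le
      simp [-Complex.ofReal_cos, -Complex.ofReal_sin]
      nlinarith
    · rw [Set.indicator_of_notMem hp']

/-- The hyperbolic area as an iterated integral in polar coordinates. -/
lemma lintegral_eq_lintegral_lintegral_polarPoint {f : ℍ → ℝ≥0∞} (hf : Measurable f) :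
    ∫⁻ z, f z = ∫⁻ r in Set.Ioi (0 : ℝ), ∫⁻ θ in Set.Ioo (0 : ℝ) Real.pi,
      ENNReal.ofReal (1 / (r * Real.sin θ ^ 2)) * f (polarPoint (r, θ)) := by
  rw [lintegral_eq_lintegral_polarPoint hf, Measure.volume_eq_prod, ← Measure.prod_restrict,
    lintegral_prod]
  have := hf.comp measurable_polarPoint
  refine Measurable.aemeasurable (Measurable.mul ?_ this)
  fun_prop

/-! ### The height function and its growth along curves. -/

/-- On the compact curve `Im z` is bounded, so hyperbolic distance controls Euclidean distance
through `exp d - 1 ≤ d exp d` with `d ≤ K`. Euclidean Lipschitz continuity gives a.e.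
differentiability and the fundamental theorem of calculus. -/
lemma lipschitzOnWith_coe {K : ℝ≥0} {z : ℝ → ℍ} (hz : LipschitzOnWith K z (Set.Icc 0 1)) :
    ∃ K' : ℝ≥0, LipschitzOnWith K' (fun t => (z t : ℂ)) (Set.Icc 0 1) := by
  obtain ⟨M, hM⟩ := (isCompact_Icc.image_of_continuousOn
    (UpperHalfPlane.continuous_im.comp_continuousOn hz.continuousOn)).bddAbove
  have hM' : ∀ t ∈ Set.Icc (0 : ℝ) 1, (z t).im ≤ M := fun t ht => hM ⟨t, ht, rfl⟩
  have hM0 : 0 ≤ M := (z 0).im_pos.le.trans (hM' 0 (by simp))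
  refine ⟨NNReal.mk (M * (K * Real.exp K)) (by positivity), LipschitzOnWith.of_dist_le_mul fun s hs t ht => ?_⟩
  have h1 := hz.dist_le_mul s hs t ht
  have h2 : dist s t ≤ 1 := by
    rw [Real.dist_eq, abs_le]
    constructor <;> linarith [hs.1, hs.2, ht.1, ht.2]
  have h3 : dist (z s) (z t) ≤ K := h1.trans (by nlinarith [K.2])
  have h4 : Real.exp (dist (z s) (z t)) - 1 ≤
      dist (z s) (z t) * Real.exp (dist (z s) (z t)) := by
    have := mul_le_mul_of_nonneg_right (Real.add_one_le_exp (-dist (z s) (z t)))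
      (Real.exp_pos (dist (z s) (z t))).le
    rw [← Real.exp_add, neg_add_cancel, Real.exp_zero] at this
    linarith
  have h5 := Real.exp_le_exp.2 h3
  calc dist (z s : ℂ) (z t) ≤ (z t).im * (Real.exp (dist (z s) (z t)) - 1) :=
        UpperHalfPlane.dist_coe_le _ _
    _ ≤ M * (dist (z s) (z t) * Real.exp (dist (z s) (z t))) :=
        mul_le_mul (hM' t ht) h4 (by have := Real.one_le_exp (dist_nonneg (x := z s) (y := z t)); linarith) hM0
    _ ≤ M * (K * dist s t * Real.exp K) := by gcongr
    _ = _ := by simp only [NNReal.coe_mk]; ring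

/-- The function `2 Re z / (|z|² + 1)`, the quotient of `sin` of the angle to the imaginary axis by
`cosh (log |z|)`. -/
noncomputable def height (w : ℂ) : ℝ := 2 * w.re / (Complex.normSq w + 1)

lemma exists_hasFDerivAt_height (w : ℂ) : ∃ L : ℂ →L[ℝ] ℝ, HasFDerivAt height L w ∧
    ∀ v, |L v| ≤ 2 / (Complex.normSq w + 1) * ‖v‖ := by
  have hD : 0 < Complex.normSq w + 1 := by have := Complex.normSq_nonneg w; linarith
  have hre : HasFDerivAt (fun w : ℂ => w.re) Complex.reCLM w := Complex.reCLM.hasFDerivAt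
  have him : HasFDerivAt (fun w : ℂ => w.im) Complex.imCLM w := Complex.imCLM.hasFDerivAt
  have hn : HasFDerivAt (fun w : ℂ => w.re * w.re + w.im * w.im + 1) _ w :=
    ((hre.mul hre).add (him.mul him)).add_const 1
  have hinv := (hasDerivAt_inv (x := w.re * w.re + w.im * w.im + 1)
    (by rw [← Complex.normSq_apply]; exact hD.ne')).comp_hasFDerivAt w hn
  have hh := (hre.const_mul 2).mul hinv
  refine ⟨_, hh, fun v => ?_⟩
  simp only [smul_apply, add_apply, Complex.reCLM_apply, Complex.imCLM_apply, smul_eq_mul,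
    Function.comp_apply, ← Complex.normSq_apply]
  have hv : |v.re * (Complex.normSq w + 1 - 2 * w.re ^ 2) - v.im * (2 * w.re * w.im)| ≤
      (Complex.normSq w + 1) * ‖v‖ := by
    apply abs_le_of_sq_le_sq _ (by positivity)
    rw [mul_pow, Complex.sq_norm, Complex.normSq_apply v]
    -- A Lagrange-type identity: the second square and the `4 (Re w)²` term are exactly what is lost
    -- in the Cauchy–Schwarz bound for the gradient.
    have e : (v.re * (Complex.normSq w + 1 - 2 * w.re ^ 2) - v.im * (2 * w.re * w.im)) ^ 2 +
        (v.re * (2 * w.re * w.im) + v.im * (Complex.normSq w + 1 - 2 * w.re ^ 2)) ^ 2 +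
        4 * w.re ^ 2 * (v.re * v.re + v.im * v.im) =
        (Complex.normSq w + 1) ^ 2 * (v.re * v.re + v.im * v.im) := by
      rw [Complex.normSq_apply]; ring
    have e2 : 0 ≤ 4 * w.re ^ 2 * (v.re * v.re + v.im * v.im) := by
      have := mul_self_nonneg v.re
      have := mul_self_nonneg v.im
      positivity
    nlinarith [sq_nonneg (v.re * (2 * w.re * w.im) +
      v.im * (Complex.normSq w + 1 - 2 * w.re ^ 2))]
  have key := mul_le_mul_of_nonneg_left hv (by positivity : 0 ≤ 2 / (Complex.normSq w + 1) ^ 2)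
  refine le_trans (le_of_eq ?_) (key.trans (le_of_eq ?_))
  · nth_rewrite 1 [← abs_of_nonneg (by positivity : 0 ≤ 2 / (Complex.normSq w + 1) ^ 2)]
    rw [← abs_mul]
    congr 1
    field_simp
    ring
  · field_simp

lemma lipschitzWith_height : LipschitzWith 2 height := by
  refine lipschitzWith_of_nnnorm_fderiv_le (𝕜 := ℝ)
    (fun w => (exists_hasFDerivAt_height w).choose_spec.1.differentiableAt) fun w => ?_
  obtain ⟨L, hL, hb⟩ := exists_hasFDerivAt_height w
  rw [hL.fderiv, ← NNReal.coe_le_coe, coe_nnnorm]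
  refine ContinuousLinearMap.opNorm_le_bound _ (by norm_num) fun v => (hb v).trans ?_
  refine mul_le_mul_of_nonneg_right ?_ (norm_nonneg v)
  have := Complex.normSq_nonneg w
  rw [div_le_iff₀ (by linarith)]
  norm_num
  linarith

/-- The increase of `height` along a curve is at most its length for `2 / (|z|² + 1) |dz|`. -/
lemma ofReal_height_sub_le {K : ℝ≥0} {z : ℝ → ℂ} (hz : LipschitzOnWith K z (Set.Icc 0 1)) :
    ENNReal.ofReal (height (z 1) - height (z 0)) ≤
      ∫⁻ t in Set.Ioo (0 : ℝ) 1,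
        ENNReal.ofReal (2 / (Complex.normSq (z t) + 1) * ‖deriv z t‖) := by
  have hl : LipschitzOnWith (2 * K) (fun t => height (z t)) (Set.uIcc 0 1) := by
    rw [Set.uIcc_of_le zero_le_one]
    exact lipschitzWith_height.comp_lipschitzOnWith hz
  have hftc := hl.absolutelyContinuousOnInterval.integral_deriv_eq_sub
  rw [← hftc, intervalIntegral.integral_of_le zero_le_one, integral_Ioc_eq_integral_Ioo]
  refine (ENNReal.ofReal_le_ofReal (le_abs_self _)).trans ?_
  rw [← Real.norm_eq_abs, ofReal_norm]
  refine (enorm_integral_le_lintegral_enorm _).trans ?_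
  refine setLIntegral_mono_ae' measurableSet_Ioo ?_
  filter_upwards [hz.ae_differentiableWithinAt_of_mem_real] with t ht hmem
  have hd : DifferentiableAt ℝ z t :=
    (ht (Set.Ioo_subset_Icc_self hmem)).differentiableAt (Icc_mem_nhds hmem.1 hmem.2)
  obtain ⟨L, hL, hb⟩ := exists_hasFDerivAt_height (z t)
  have := hL.comp_hasDerivAt t hd.hasDerivAt
  rw [show deriv (fun t => height (z t)) t = L (deriv z t) from this.deriv, ← ofReal_norm]
  exact ENNReal.ofReal_le_ofReal (hb _)

/-! ### Upper bound for the modulus: an explicit admissible metric. -/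

namespace Hexagon

variable (H : Hexagon)

lemma measurable_fold : Measurable H.fold :=
  measurable_from_quotient.2 (measurable_subtype_coe.comp measurable_snd)

lemma measurable_eval (L : GeodesicForm) : Measurable fun z : ℍ => L.eval z := by
  unfold GeodesicForm.eval
  have := UpperHalfPlane.measurable_coe
  have h : Measurable Complex.normSq := Complex.continuous_normSq.measurable
  fun_prop

lemma measurableSet_region : MeasurableSet H.region := by
  have h : ∀ L : GeodesicForm, MeasurableSet {z : ℍ | 0 ≤ L.eval z} := fun L =>
    measurableSet_le measurable_const (measurable_eval L)
  exact (h _).inter ((h _).inter ((h _).inter ((h _).inter ((h _).inter (h _)))))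

lemma lintegral_area {f : H.Pants → ℝ≥0∞} (hf : Measurable f) : ∫⁻ x, f x ∂H.area =
    ∑ s : Bool, ∫⁻ z, f (H.sheet s z) ∂(volume.comap (Subtype.val : H.region → ℍ)) := by
  rw [area, lintegral_finsetSum_measure]
  exact Finset.sum_congr rfl fun s _ => lintegral_map hf (H.measurable_sheet s)

/-- The density, with respect to the hyperbolic metric, of a metric that dominates the gradient of
`height / tanh ℓ(η)` between `α` and `β`. -/
noncomputable def collarDensity : ℍ → ℝ≥0∞ :=
  {z : ℍ | 0 ≤ z.re ∧ 0 ≤ H.betaLine.eval z}.indicator fun z =>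
    ENNReal.ofReal (2 * z.im / (H.etaTanh * (Complex.normSq z + 1)))

lemma measurable_collarDensity : Measurable H.collarDensity := by
  refine Measurable.indicator ?_ ?_
  · have h := UpperHalfPlane.continuous_im.measurable
    have h1 := UpperHalfPlane.measurable_coe
    have h2 : Measurable Complex.normSq := Complex.continuous_normSq.measurable
    fun_prop
  · exact (measurableSet_le measurable_const UpperHalfPlane.continuous_re.measurable).inter
      (measurableSet_le measurable_const (measurable_eval _))

/-- Along such a curve `height` climbs from `0` to `etaTanh`. The factor `Im z` in the density
cancels the one in the hyperbolic speed, leaving the Euclidean integrand that bounds this increase.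
-/
lemma one_le_rhoLength_collarDensity {c : ℝ → H.Pants}
    (hc : c ∈ H.joiningCurves H.halfCollar H.alpha H.beta) :
    1 ≤ H.rhoLength (fun x => H.collarDensity (H.fold x)) c := by
  obtain ⟨⟨-, K, hK⟩, h0, h1, hI⟩ := hc
  have hτ := H.etaTanh_pos
  obtain ⟨K', hK'⟩ := lipschitzOnWith_coe hK
  have key := ofReal_height_sub_le hK'
  have e0 : height (H.fold (c 0)) = 0 := by
    have h : (H.fold (c 0)).re = 0 := by
      simpa [alpha, GeodesicForm.eval, alphaLine] using h0
    simp [height, h]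
  have e1 : height (H.fold (c 1)) = H.etaTanh := by
    have h : 2 * (H.fold (c 1) : ℂ).re =
      H.etaTanh * (Complex.normSq (H.fold (c 1)) + 1) := (H.betaLine_eval_eq_zero_iff _).1 h1
    rw [height, h, mul_div_cancel_right₀]
    have := Complex.normSq_nonneg (H.fold (c 1))
    positivity
  rw [e0, e1, sub_zero] at key
  have key2 := mul_le_mul_right key (ENNReal.ofReal H.etaTanh⁻¹)
  rw [← ENNReal.ofReal_mul (by positivity), inv_mul_cancel₀ hτ.ne', ENNReal.ofReal_one] at key2
  refine key2.trans ?_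
  rw [← lintegral_const_mul' _ _ ENNReal.ofReal_ne_top, rhoLength]
  refine le_trans ?_ (lintegral_mono_set Set.Ioo_subset_Icc_self)
  refine setLIntegral_mono' measurableSet_Ioo fun t ht => le_of_eq ?_
  have hm : H.fold (c t) ∈ {z : ℍ | 0 ≤ z.re ∧ 0 ≤ H.betaLine.eval z} := by
    obtain ⟨ha, hb⟩ := hI t ht
    refine ⟨?_, hb.le⟩
    simpa [GeodesicForm.eval, alphaLine] using ha.le
  have hn := Complex.normSq_nonneg (H.fold (c t))
  have him := (H.fold (c t)).im_pos
  rw [collarDensity, Set.indicator_of_mem hm, speed, ← ENNReal.ofReal_mul (by positivity),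
    ← ENNReal.ofReal_mul (by positivity)]
  congr 1
  field_simp

lemma lintegral_collarDensity_sq_le :
    ∫⁻ z, H.collarDensity z ^ 2 ≤ ENNReal.ofReal (Real.pi ^ 2 / H.etaTanh) := by
  have hτ := H.etaTanh_pos
  have hπ := Real.pi_pos
  rw [lintegral_eq_lintegral_lintegral_polarPoint (H.measurable_collarDensity.pow_const 2)]
  have hr : ∀ r ∈ Set.Ioi (0 : ℝ), ∫⁻ θ in Set.Ioo (0 : ℝ) Real.pi,
      ENNReal.ofReal (1 / (r * Real.sin θ ^ 2)) * H.collarDensity (polarPoint (r, θ)) ^ 2 ≤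
      ENNReal.ofReal (Real.pi / H.etaTanh * (1 + r ^ 2)⁻¹) := by
    intro r hr
    have hr0 : 0 < r := hr
    -- On the collar `cos θ ≤ etaTanh (r² + 1) / (2 r)`; Jordan's inequality then confines `π/2 - θ`
    -- to `[0, w]`.
    set w := Real.pi / 2 * (H.etaTanh * (r ^ 2 + 1) / (2 * r)) with hw
    calc _ ≤ ∫⁻ θ in Set.Ioo (0 : ℝ) Real.pi, (Set.Icc (Real.pi / 2 - w) (Real.pi / 2)).indicator
          (fun _ => ENNReal.ofReal (4 * r / (H.etaTanh ^ 2 * (r ^ 2 + 1) ^ 2))) θ := by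
          refine setLIntegral_mono' measurableSet_Ioo fun θ hθ => ?_
          have hs := Real.sin_pos_of_mem_Ioo hθ
          by_cases hm : polarPoint (r, θ) ∈ {z : ℍ | 0 ≤ z.re ∧ 0 ≤ H.betaLine.eval z}
          · rw [collarDensity, Set.indicator_of_mem hm, polarPoint_im hr0 hθ,
              normSq_polarPoint hr0 hθ, ← ENNReal.ofReal_pow (by positivity),
              ← ENNReal.ofReal_mul (by positivity)]
            obtain ⟨m1, m2⟩ := hm
            have m3 := (H.betaLine_eval_nonneg_iff _).1 m2
            rw [UpperHalfPlane.coe_re, polarPoint_re hr0 hθ, normSq_polarPoint hr0 hθ] at m3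
            rw [polarPoint_re hr0 hθ] at m1
            simp only at m1 m3
            have hcos : 0 ≤ Real.cos θ := nonneg_of_mul_nonneg_right m1 hr0
            have hθ2 : θ ≤ Real.pi / 2 := by
              by_contra h
              exact absurd hcos (not_le.2 (Real.cos_neg_of_pi_div_two_lt_of_lt (not_le.1 h)
                (by have := hθ.2; linarith)))
            have hj := Real.mul_le_sin (x := Real.pi / 2 - θ) (by linarith)
              (by have := hθ.1; linarith)
            rw [Real.sin_pi_div_two_sub] at hj
            have hθ1 : Real.pi / 2 - w ≤ θ := by
              have : Real.cos θ ≤ H.etaTanh * (r ^ 2 + 1) / (2 * r) := by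
                rw [le_div_iff₀ (by positivity)]; linarith
              have := mul_le_mul_of_nonneg_left (hj.trans this) (by positivity : 0 ≤ Real.pi / 2)
              rw [← hw, ← mul_assoc] at this
              have e : Real.pi / 2 * (2 / Real.pi) = 1 := by field_simp
              rw [e] at this
              linarith
            have hI : θ ∈ Set.Icc (Real.pi / 2 - w) (Real.pi / 2) := ⟨hθ1, hθ2⟩
            rw [Set.indicator_of_mem hI]
            apply ENNReal.ofReal_le_ofReal
            apply le_of_eq
            simp only
            field_simp
            norm_num
          · rw [collarDensity, Set.indicator_of_notMem hm]
            simp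
      _ ≤ ∫⁻ θ, (Set.Icc (Real.pi / 2 - w) (Real.pi / 2)).indicator
          (fun _ => ENNReal.ofReal (4 * r / (H.etaTanh ^ 2 * (r ^ 2 + 1) ^ 2))) θ :=
          setLIntegral_le_lintegral _ _
      _ = ENNReal.ofReal (4 * r / (H.etaTanh ^ 2 * (r ^ 2 + 1) ^ 2)) * ENNReal.ofReal w := by
          rw [lintegral_indicator_const measurableSet_Icc, Real.volume_Icc]
          congr 2
          ring
      _ = _ := by
          rw [← ENNReal.ofReal_mul (by positivity)]
          congr 1
          rw [hw]
          field_simp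
          ring
  refine (setLIntegral_mono' measurableSet_Ioi hr).trans ?_
  -- Extending to all real `r` costs a factor `2` and leaves the integral of `1 / (1 + r²)`, which
  -- is `π`.
  refine (setLIntegral_le_lintegral _ _).trans ?_
  rw [← ofReal_integral_eq_lintegral_ofReal (integrable_inv_one_add_sq.const_mul _)
    (Filter.Eventually.of_forall fun r => by positivity), integral_const_mul,
    integral_univ_inv_one_add_sq]
  apply le_of_eq
  congr 1
  ring

lemma modulus_le :
    H.modulus (H.joiningCurves H.halfCollar H.alpha H.beta) ≤
      ENNReal.ofReal (2 * Real.pi ^ 2 / H.etaTanh) := by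
  have hτ := H.etaTanh_pos
  have hm : Measurable fun x : H.Pants => H.collarDensity (H.fold x) :=
    H.measurable_collarDensity.comp H.measurable_fold
  refine (iInf₂_le _ hm).trans ((iInf_le _ fun c hc => H.one_le_rhoLength_collarDensity hc).trans ?_)
  rw [lintegral_area H (hm.pow_const 2)]
  have h : ∀ s : Bool, ∫⁻ z, H.collarDensity (H.fold (H.sheet s z)) ^ 2
      ∂(volume.comap (Subtype.val : H.region → ℍ)) ≤ ENNReal.ofReal (Real.pi ^ 2 / H.etaTanh) := by
    intro s
    refine le_trans (le_of_eq ?_) ((setLIntegral_le_lintegral H.region _).trans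
      H.lintegral_collarDensity_sq_le)
    exact lintegral_subtype_comap H.measurableSet_region (fun z => H.collarDensity z ^ 2)
  refine (Finset.sum_le_sum fun s _ => h s).trans (le_of_eq ?_)
  rw [Fintype.sum_bool, ← ENNReal.ofReal_add (by positivity) (by positivity)]
  congr 1
  ring

end Hexagon

/-! ### Lower bound for the modulus: circular arcs and Cauchy–Schwarz. -/

lemma coe_polarPoint_eq_exp {p : ℝ × ℝ} (h1 : 0 < p.1) (h2 : p.2 ∈ Set.Ioo 0 Real.pi) :
    (polarPoint p : ℂ) = p.1 * Complex.exp (p.2 * Complex.I) := by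
  rw [coe_polarPoint h1 h2, Complex.exp_mul_I, ← Complex.ofReal_cos, ← Complex.ofReal_sin]
  apply Complex.ext <;> simp [-Complex.ofReal_cos, -Complex.ofReal_sin]

lemma pi_div_two_sub_mem_Ioo {f u : ℝ} (hf : f < Real.pi / 2) (hu : u ∈ Set.Icc 0 f) :
    Real.pi / 2 - u ∈ Set.Ioo 0 Real.pi := by
  have := Real.pi_pos
  constructor <;> linarith [hu.1, hu.2]

lemma dist_polarPoint_le {r f : ℝ} (hr : 0 < r) (hf : f < Real.pi / 2) {u v : ℝ}
    (hu : u ∈ Set.Icc 0 f) (hv : v ∈ Set.Icc 0 f) :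
    dist (polarPoint (r, Real.pi / 2 - u)) (polarPoint (r, Real.pi / 2 - v)) ≤
      2 / Real.cos f * |u - v| := by
  have hπ := Real.pi_pos
  have hf0 : 0 ≤ f := hu.1.trans hu.2
  have hcos : 0 < Real.cos f := Real.cos_pos_of_mem_Ioo ⟨by linarith, hf⟩
  have mu := pi_div_two_sub_mem_Ioo hf hu
  have mv := pi_div_two_sub_mem_Ioo hf hv
  have hcu : Real.cos f ≤ Real.cos u :=
    Real.cos_le_cos_of_nonneg_of_le_pi hu.1 (by linarith) hu.2
  have hcv : Real.cos f ≤ Real.cos v :=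
    Real.cos_le_cos_of_nonneg_of_le_pi hv.1 (by linarith) hv.2
  have h1 : r * Real.cos f ≤ √((polarPoint (r, Real.pi / 2 - u)).im *
      (polarPoint (r, Real.pi / 2 - v)).im) := by
    apply Real.le_sqrt_of_sq_le
    rw [polarPoint_im hr mu, polarPoint_im hr mv]
    simp only [Real.sin_pi_div_two_sub]
    have := mul_le_mul hcu hcv hcos.le (hcos.le.trans hcu)
    nlinarith [mul_le_mul_of_nonneg_left this (sq_nonneg r)]
  have h2 : dist (polarPoint (r, Real.pi / 2 - u) : ℂ) (polarPoint (r, Real.pi / 2 - v)) ≤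
      2 * r * |u - v| := by
    rw [Complex.dist_eq, coe_polarPoint hr mu, coe_polarPoint hr mv]
    refine (Complex.norm_le_abs_re_add_abs_im _).trans ?_
    simp only [Complex.sub_re, Complex.sub_im, Real.sin_pi_div_two_sub, Real.cos_pi_div_two_sub]
    rw [← mul_sub, ← mul_sub, abs_mul, abs_mul, abs_of_pos hr]
    nlinarith [Real.abs_sin_sub_sin_le u v, Real.abs_cos_sub_cos_le u v]
  refine (UpperHalfPlane.dist_le_dist_coe_div_sqrt _ _).trans ?_
  refine (div_le_div₀ (by positivity) h2 (by positivity) h1).trans (le_of_eq ?_)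
  field_simp

/-- The Cauchy–Schwarz inequality for a function of integral at least one. -/
lemma one_le_mul_lintegral_sq {S : Set ℝ} {k : ℝ → ℝ≥0∞} {f : ℝ} (hf : 0 < f)
    (hS : volume S = ENNReal.ofReal f) (hk : 1 ≤ ∫⁻ x in S, k x) :
    1 ≤ ENNReal.ofReal f * ∫⁻ x in S, k x ^ 2 := by
  -- Integrating the pointwise form `(f y - 1)² ≥ 0` of Cauchy–Schwarz requires neither
  -- measurability nor finiteness of `k`.
  have h : ∀ y : ℝ≥0∞, 2 * y ≤ ENNReal.ofReal f * y ^ 2 + ENNReal.ofReal (1 / f) := by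
    intro y
    rcases eq_or_ne y ∞ with rfl | hy
    · simp [hf]
    · lift y to ℝ≥0 using hy
      rw [ENNReal.ofReal, ENNReal.ofReal]
      norm_cast
      rw [← NNReal.coe_le_coe]
      push_cast
      rw [Real.coe_toNNReal _ hf.le, Real.coe_toNNReal _ (by positivity), ← sub_nonneg]
      have : f * (y : ℝ) ^ 2 + 1 / f - 2 * y = (f * y - 1) ^ 2 / f := by field_simp; ring
      rw [this]
      positivity
  have h1 : (2 : ℝ≥0∞) ≤ ENNReal.ofReal f * (∫⁻ x in S, k x ^ 2) + 1 := by
    calc (2 : ℝ≥0∞) = 2 * 1 := (mul_one _).symm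
      _ ≤ 2 * ∫⁻ x in S, k x := by gcongr
      _ = ∫⁻ x in S, 2 * k x := (lintegral_const_mul' _ _ (by simp)).symm
      _ ≤ ∫⁻ x in S, (ENNReal.ofReal f * k x ^ 2 + ENNReal.ofReal (1 / f)) :=
          lintegral_mono fun x => h _
      _ = _ := by
          rw [lintegral_add_right _ measurable_const, lintegral_const_mul' _ _ (by simp),
            setLIntegral_const, hS, ← ENNReal.ofReal_mul (by positivity),
            one_div_mul_cancel hf.ne', ENNReal.ofReal_one]
  rw [← one_add_one_eq_two] at h1
  exact ENNReal.le_of_add_le_add_right ENNReal.one_ne_top h1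

namespace Hexagon

variable (H : Hexagon)

/-- The angle that the collar subtends on the circle of radius `r`. -/
noncomputable def collarAngle (r : ℝ) : ℝ := Real.arcsin (H.etaTanh * (r ^ 2 + 1) / (2 * r))

variable {H}

/-- The left side is `etaTanh * cosh (log r)`, which is less than `etaTanh * cosh a = gammaTanh ≤
1`. So the circle does meet `β`, before running into the real axis. -/
lemma collarAngle_arg_lt_one {r : ℝ} (h1 : 1 < r) (hE : r < Real.exp H.a) :
    H.etaTanh * (r ^ 2 + 1) / (2 * r) < 1 := by
  have hE1 := H.one_lt_exp
  rw [div_lt_one (by linarith)]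
  have h2 := H.etaTanh_mul_exp
  have h3 := H.gammaTanh_le_one
  have h4 := H.etaTanh_pos
  -- This product equals `r (E² + 1) - E (r² + 1)` with `E = exp a`, i.e. `r + 1/r < E + 1/E`.
  have h5 : 0 < (Real.exp H.a - r) * (r * Real.exp H.a - 1) :=
    mul_pos (by linarith) (by nlinarith)
  refine lt_of_mul_lt_mul_right (a := Real.exp H.a) ?_ (Real.exp_pos _).le
  have h6 := mul_pos h4 h5
  have h7 := mul_le_mul_of_nonneg_right h3
    (mul_nonneg (Real.exp_pos H.a).le (by linarith : 0 ≤ 2 * r))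
  nlinarith

lemma collarAngle_pos {r : ℝ} (h1 : 1 < r) : 0 < H.collarAngle r := by
  have := H.etaTanh_pos
  exact Real.arcsin_pos.2 (by positivity)

lemma collarAngle_lt {r : ℝ} (h1 : 1 < r) (hE : r < Real.exp H.a) :
    H.collarAngle r < Real.pi / 2 :=
  Real.arcsin_lt_pi_div_two.2 (collarAngle_arg_lt_one h1 hE)

lemma sin_collarAngle {r : ℝ} (h1 : 1 < r) (hE : r < Real.exp H.a) :
    Real.sin (H.collarAngle r) = H.etaTanh * (r ^ 2 + 1) / (2 * r) := by
  have := H.etaTanh_pos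
  have h0 : 0 ≤ H.etaTanh * (r ^ 2 + 1) / (2 * r) := by positivity
  exact Real.sin_arcsin (by linarith) (collarAngle_arg_lt_one h1 hE).le

lemma collarAngle_le {r : ℝ} (h1 : 1 < r) (hE : r < Real.exp H.a) :
    H.collarAngle r ≤ Real.pi / 2 * (H.etaTanh * (r ^ 2 + 1) / (2 * r)) := by
  have hπ := Real.pi_pos
  rw [← sin_collarAngle h1 hE]
  have := mul_le_mul_of_nonneg_left
    (Real.mul_le_sin (collarAngle_pos (H := H) h1).le (collarAngle_lt h1 hE).le)
    (by positivity : 0 ≤ Real.pi / 2)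
  rw [← mul_assoc] at this
  have e : Real.pi / 2 * (2 / Real.pi) = 1 := by field_simp
  rwa [e, one_mul] at this

lemma sin_le_sin_collarAngle {r u : ℝ} (h1 : 1 < r) (hE : r < Real.exp H.a)
    (hu : u ∈ Set.Icc 0 (H.collarAngle r)) : Real.sin u ≤ Real.sin (H.collarAngle r) := by
  have hπ := Real.pi_pos
  have := collarAngle_lt h1 hE
  exact Real.sin_le_sin_of_le_of_le_pi_div_two (by linarith [hu.1]) this.le hu.2

lemma polarPoint_mem_region {r u : ℝ} (h1 : 1 < r) (hE : r < Real.exp H.a)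
    (hu : u ∈ Set.Icc 0 (H.collarAngle r)) : polarPoint (r, Real.pi / 2 - u) ∈ H.region := by
  have hr : 0 < r := by linarith
  have hπ := Real.pi_pos
  have hf := collarAngle_lt h1 hE
  have mu := pi_div_two_sub_mem_Ioo hf hu
  have hs := sin_le_sin_collarAngle h1 hE hu
  rw [sin_collarAngle h1 hE, le_div_iff₀ (by positivity)] at hs
  have hre : (polarPoint (r, Real.pi / 2 - u)).re = r * Real.sin u := by
    rw [polarPoint_re hr mu]; simp only [Real.cos_pi_div_two_sub]
  have hn : Complex.normSq (polarPoint (r, Real.pi / 2 - u)) = r ^ 2 := normSq_polarPoint hr mu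
  have hsin : 0 ≤ Real.sin u := Real.sin_nonneg_of_nonneg_of_le_pi hu.1 (by linarith [hu.2])
  refine H.mem_region_of_le ?_ ?_ ?_ ?_
  · rw [hre]; positivity
  · rw [hn]; nlinarith
  · rw [hn]; gcongr
  · rw [hn, hre]; linarith

/-- The arc of radius `r` from `α` to `β` in one of the two hexagons. -/
noncomputable def collarArc {r : ℝ} (h1 : 1 < r) (hE : r < Real.exp H.a) (t : ℝ) : H.Pants :=
  H.sheet false ⟨polarPoint (r, Real.pi / 2 -
      H.collarAngle r * (Set.projIcc (0 : ℝ) 1 zero_le_one t : ℝ)),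
    polarPoint_mem_region h1 hE (by
      have h := (Set.projIcc (0 : ℝ) 1 zero_le_one t).2
      have hf := (collarAngle_pos (H := H) h1).le
      exact ⟨mul_nonneg hf h.1, mul_le_of_le_one_right hf h.2⟩)⟩

lemma fold_collarArc {r : ℝ} (h1 : 1 < r) (hE : r < Real.exp H.a) (t : ℝ) :
    H.fold (collarArc h1 hE t) = polarPoint (r, Real.pi / 2 -
      H.collarAngle r * (Set.projIcc (0 : ℝ) 1 zero_le_one t : ℝ)) := rfl

lemma mul_mem_Icc_collarAngle {r t : ℝ} (h1 : 1 < r) (ht : t ∈ Set.Icc (0 : ℝ) 1) :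
    H.collarAngle r * t ∈ Set.Icc 0 (H.collarAngle r) := by
  have hf := (collarAngle_pos (H := H) h1).le
  exact ⟨mul_nonneg hf ht.1, mul_le_of_le_one_right hf ht.2⟩

lemma fold_collarArc_of_mem {r : ℝ} (h1 : 1 < r) (hE : r < Real.exp H.a) {t : ℝ}
    (ht : t ∈ Set.Icc (0 : ℝ) 1) :
    H.fold (collarArc h1 hE t) = polarPoint (r, Real.pi / 2 - H.collarAngle r * t) := by
  rw [fold_collarArc, Set.projIcc_of_mem _ ht]

/-- The arc stays at angle at most `collarAngle r < π/2` from the imaginary axis, hence away from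
the real axis. Clamping the parameter to `[0, 1]` makes the Lipschitz bound global. -/
lemma isCurve_collarArc {r : ℝ} (h1 : 1 < r) (hE : r < Real.exp H.a) :
    H.IsCurve (collarArc h1 hE) := by
  have hr : 0 < r := by linarith
  have hf := collarAngle_pos (H := H) h1
  have hf2 := collarAngle_lt h1 hE
  have hcos : 0 < Real.cos (H.collarAngle r) :=
    Real.cos_pos_of_mem_Ioo ⟨by linarith [Real.pi_pos], hf2⟩
  have hL : LipschitzWith (NNReal.mk (2 / Real.cos (H.collarAngle r) * H.collarAngle r)
      (by positivity)) fun t => H.fold (collarArc h1 hE t) := by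
    refine LipschitzWith.of_dist_le_mul fun s t => ?_
    rw [fold_collarArc, fold_collarArc]
    refine (dist_polarPoint_le hr hf2 (mul_mem_Icc_collarAngle h1 (Subtype.property _))
      (mul_mem_Icc_collarAngle h1 (Subtype.property _))).trans ?_
    rw [← mul_sub, abs_mul, abs_of_pos hf, ← mul_assoc]
    refine mul_le_mul_of_nonneg_left ?_ (by positivity)
    exact (LipschitzWith.projIcc (zero_le_one' ℝ)).dist_le_mul s t |>.trans (by simp)
  refine ⟨Continuous.continuousOn ?_, _, hL.lipschitzOnWith⟩
  exact (H.continuous_sheet false).comp (hL.continuous.subtype_mk _)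

lemma collarArc_mem_joiningCurves {r : ℝ} (h1 : 1 < r) (hE : r < Real.exp H.a) :
    collarArc h1 hE ∈ H.joiningCurves H.halfCollar H.alpha H.beta := by
  have hr : 0 < r := by linarith
  have hπ := Real.pi_pos
  have hf := collarAngle_pos (H := H) h1
  have hf2 := collarAngle_lt h1 hE
  have hre : ∀ t ∈ Set.Icc (0 : ℝ) 1, (H.fold (collarArc h1 hE t) : ℂ).re =
      r * Real.sin (H.collarAngle r * t) := by
    intro t ht
    rw [fold_collarArc_of_mem h1 hE ht, UpperHalfPlane.coe_re,
      polarPoint_re hr (pi_div_two_sub_mem_Ioo hf2 (mul_mem_Icc_collarAngle h1 ht))]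
    simp only [Real.cos_pi_div_two_sub]
  have hn : ∀ t ∈ Set.Icc (0 : ℝ) 1, Complex.normSq (H.fold (collarArc h1 hE t)) = r ^ 2 := by
    intro t ht
    rw [fold_collarArc_of_mem h1 hE ht]
    exact normSq_polarPoint hr (pi_div_two_sub_mem_Ioo hf2 (mul_mem_Icc_collarAngle h1 ht))
  have hsin := sin_collarAngle h1 hE
  rw [eq_div_iff (by positivity)] at hsin
  refine ⟨isCurve_collarArc h1 hE, ?_, ?_, fun t ht => ⟨?_, ?_⟩⟩
  · change alphaLine.eval _ = 0
    simp only [GeodesicForm.eval, alphaLine, hre 0 (by simp)]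
    simp
  · refine (H.betaLine_eval_eq_zero_iff _).2 ?_
    rw [hre 1 (by simp), hn 1 (by simp), mul_one]
    linarith
  · have : 0 < Real.sin (H.collarAngle r * t) :=
      Real.sin_pos_of_pos_of_lt_pi (mul_pos hf ht.1) (by nlinarith [ht.2])
    simp only [GeodesicForm.eval, alphaLine, hre t (Set.Ioo_subset_Icc_self ht)]
    have := mul_pos hr this
    linarith
  · refine (H.betaLine_eval_pos_iff _).2 ?_
    rw [hre t (Set.Ioo_subset_Icc_self ht), hn t (Set.Ioo_subset_Icc_self ht)]
    have : Real.sin (H.collarAngle r * t) < Real.sin (H.collarAngle r) :=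
      Real.sin_lt_sin_of_lt_of_le_pi_div_two (by nlinarith [ht.1]) hf2.le (by nlinarith [ht.2])
    nlinarith

lemma speed_collarArc {r : ℝ} (h1 : 1 < r) (hE : r < Real.exp H.a) {t : ℝ}
    (ht : t ∈ Set.Ioo (0 : ℝ) 1) : H.speed (collarArc h1 hE) t =
      H.collarAngle r * (1 / Real.sin (Real.pi / 2 - H.collarAngle r * t)) := by
  have hr : 0 < r := by linarith
  have hf := collarAngle_pos (H := H) h1
  have hf2 := collarAngle_lt h1 hE
  have hev : (fun s => (H.fold (collarArc h1 hE s) : ℂ)) =ᶠ[nhds t] fun s =>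
      r * Complex.exp (((Real.pi / 2 - H.collarAngle r * s : ℝ) : ℂ) * Complex.I) := by
    filter_upwards [Ioo_mem_nhds ht.1 ht.2] with s hs
    have hs' := Set.Ioo_subset_Icc_self hs
    rw [fold_collarArc_of_mem h1 hE hs']
    exact coe_polarPoint_eq_exp hr (pi_div_two_sub_mem_Ioo hf2 (mul_mem_Icc_collarAngle h1 hs'))
  have hd0 : HasDerivAt (fun s : ℝ => Real.pi / 2 - H.collarAngle r * s) (-H.collarAngle r) t := by
    simpa using ((hasDerivAt_id t).const_mul (H.collarAngle r)).const_sub (Real.pi / 2)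
  have hd := ((hd0.ofReal_comp.mul_const Complex.I).cexp).const_mul (r : ℂ)
  rw [speed, hev.deriv_eq, hd.deriv, fold_collarArc_of_mem h1 hE (Set.Ioo_subset_Icc_self ht),
    polarPoint_im hr (pi_div_two_sub_mem_Ioo hf2
      (mul_mem_Icc_collarAngle h1 (Set.Ioo_subset_Icc_self ht)))]
  rw [norm_mul, norm_mul, Complex.norm_exp_ofReal_mul_I, norm_mul, Complex.norm_I,
    Complex.norm_real, Complex.norm_real, Real.norm_eq_abs, Real.norm_eq_abs, abs_neg,
    abs_of_pos hr, abs_of_pos hf]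
  field_simp

variable (H) in
/-- The restriction of a density to one of the two hexagons, extended by zero. -/
noncomputable def sheetDensity (ρ : H.Pants → ℝ≥0∞) : ℍ → ℝ≥0∞ :=
  Function.extend (Subtype.val : H.region → ℍ) (fun z => ρ (H.sheet false z)) 0

lemma sheetDensity_coe (ρ : H.Pants → ℝ≥0∞) (z : H.region) :
    H.sheetDensity ρ z = ρ (H.sheet false z) := Subtype.val_injective.extend_apply _ _ _

lemma measurable_sheetDensity {ρ : H.Pants → ℝ≥0∞} (hρ : Measurable ρ) :
    Measurable (H.sheetDensity ρ) :=
  (MeasurableEmbedding.subtype_coe H.measurableSet_region).measurable_extend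
    (hρ.comp (H.measurable_sheet false)) measurable_const

lemma lintegral_sheetDensity_sq_le {ρ : H.Pants → ℝ≥0∞} (hρ : Measurable ρ) :
    ∫⁻ z, H.sheetDensity ρ z ^ 2 ≤ ∫⁻ x, ρ x ^ 2 ∂H.area := by
  rw [H.lintegral_area (hρ.pow_const 2), Fintype.sum_bool]
  -- The area in the other hexagon is discarded.
  refine le_trans (le_of_eq ?_) le_add_self
  have h : ∀ z : ℍ, H.sheetDensity ρ z ^ 2 =
      H.region.indicator (fun z => H.sheetDensity ρ z ^ 2) z := by
    intro z
    by_cases hz : z ∈ H.region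
    · rw [Set.indicator_of_mem hz]
    · rw [Set.indicator_of_notMem hz, sheetDensity, Function.extend_apply']
      · simp
      · rintro ⟨w, rfl⟩
        exact hz w.2
  rw [lintegral_congr h, lintegral_indicator H.measurableSet_region,
    ← lintegral_subtype_comap H.measurableSet_region]
  exact lintegral_congr fun z => by rw [sheetDensity_coe]

/-- Change of variables from the parameter of the arc to the polar angle, the hyperbolic length
element on `|z| = r` being `dθ / sin θ`. -/
lemma one_le_lintegral_sheetDensity {ρ : H.Pants → ℝ≥0∞} {r : ℝ} (h1 : 1 < r)
    (hE : r < Real.exp H.a) (hρ : 1 ≤ H.rhoLength ρ (collarArc h1 hE)) :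
    1 ≤ ∫⁻ θ in Set.Ioo (Real.pi / 2 - H.collarAngle r) (Real.pi / 2),
      H.sheetDensity ρ (polarPoint (r, θ)) * ENNReal.ofReal (1 / Real.sin θ) := by
  have hf := collarAngle_pos (H := H) h1
  have himg : (fun t : ℝ => Real.pi / 2 - H.collarAngle r * t) '' Set.Ioo 0 1 ⊆
      Set.Ioo (Real.pi / 2 - H.collarAngle r) (Real.pi / 2) := by
    rintro _ ⟨t, ht, rfl⟩
    constructor <;> simp only <;> nlinarith [ht.1, ht.2]
  refine hρ.trans (le_trans (le_of_eq ?_) (lintegral_mono_set himg))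
  rw [lintegral_image_eq_lintegral_abs_deriv_mul (f' := fun _ => -H.collarAngle r)
    measurableSet_Ioo, rhoLength, setLIntegral_congr Ioo_ae_eq_Icc.symm]
  · refine setLIntegral_congr_fun measurableSet_Ioo fun t ht => ?_
    have hmem := Set.Ioo_subset_Icc_self ht
    have e : H.sheetDensity ρ (polarPoint (r, Real.pi / 2 - H.collarAngle r * t)) =
        ρ (collarArc h1 hE t) := by
      rw [← fold_collarArc_of_mem h1 hE hmem, fold_collarArc]
      exact sheetDensity_coe ρ ⟨_, _⟩
    rw [speed_collarArc h1 hE ht, e, abs_neg, abs_of_pos hf, ENNReal.ofReal_mul hf.le]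
    ring
  · intro t _
    simpa using (((hasDerivAt_id t).const_mul (H.collarAngle r)).const_sub
      (Real.pi / 2)).hasDerivWithinAt
  · intro s _ t _ hst
    have := mul_left_cancel₀ hf.ne' (sub_right_injective hst)
    exact this

lemma le_lintegral_sheetDensity_sq (ha : 3 / 2 ≤ Real.exp H.a) {ρ : H.Pants → ℝ≥0∞}
    (hm : Measurable ρ)
    (hρ : ∀ c ∈ H.joiningCurves H.halfCollar H.alpha H.beta, 1 ≤ H.rhoLength ρ c) :
    ENNReal.ofReal (1 / (2 * Real.pi * H.etaTanh)) ≤ ∫⁻ z, H.sheetDensity ρ z ^ 2 := by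
  have hτ := H.etaTanh_pos
  have hπ := Real.pi_pos
  rw [lintegral_eq_lintegral_lintegral_polarPoint ((measurable_sheetDensity hm).pow_const 2)]
  have hsub : Set.Ioo (1 : ℝ) (3 / 2) ⊆ Set.Ioi 0 := fun r hr => one_pos.trans hr.1
  refine le_trans ?_ (lintegral_mono_set hsub)
  have hr : ∀ r ∈ Set.Ioo (1 : ℝ) (3 / 2), ENNReal.ofReal (1 / (Real.pi * H.etaTanh)) ≤
      ∫⁻ θ in Set.Ioo (0 : ℝ) Real.pi, ENNReal.ofReal (1 / (r * Real.sin θ ^ 2)) *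
        H.sheetDensity ρ (polarPoint (r, θ)) ^ 2 := by
    intro r hr
    have h1 := hr.1
    have hE := hr.2.trans_le ha
    have hr0 : 0 < r := hsub hr
    have hf := collarAngle_pos (H := H) h1
    have hf2 := collarAngle_lt h1 hE
    have key := one_le_mul_lintegral_sq hf (by rw [Real.volume_Ioo]; congr 1; ring)
      (one_le_lintegral_sheetDensity h1 hE (hρ _ (collarArc_mem_joiningCurves h1 hE)))
    have hI : Set.Ioo (Real.pi / 2 - H.collarAngle r) (Real.pi / 2) ⊆ Set.Ioo 0 Real.pi :=
      Set.Ioo_subset_Ioo (by linarith) (by linarith)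
    refine le_trans ?_ (lintegral_mono_set hI)
    -- The area weight `1 / (r sin² θ)` is `1 / r` times the square of the length weight, so
    -- Cauchy–Schwarz applies to the squared length integrand.
    have e : ∫⁻ θ in Set.Ioo (Real.pi / 2 - H.collarAngle r) (Real.pi / 2),
        ENNReal.ofReal (1 / (r * Real.sin θ ^ 2)) * H.sheetDensity ρ (polarPoint (r, θ)) ^ 2 =
        ENNReal.ofReal (1 / r) * ∫⁻ θ in Set.Ioo (Real.pi / 2 - H.collarAngle r) (Real.pi / 2),
        (H.sheetDensity ρ (polarPoint (r, θ)) * ENNReal.ofReal (1 / Real.sin θ)) ^ 2 := by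
      rw [← lintegral_const_mul' _ _ ENNReal.ofReal_ne_top]
      refine setLIntegral_congr_fun measurableSet_Ioo fun θ hθ => ?_
      have hs := Real.sin_pos_of_mem_Ioo (hI hθ)
      rw [mul_pow, ← ENNReal.ofReal_pow (by positivity), mul_comm (H.sheetDensity ρ _ ^ 2),
        ← mul_assoc, ← ENNReal.ofReal_mul (by positivity)]
      congr 2
      field_simp
    rw [e]
    -- By Jordan's inequality `r * collarAngle r ≤ π etaTanh (r² + 1) / 4`, and `r² + 1 ≤ 4` for `r
    -- < 3/2`.
    have hle : 1 / (Real.pi * H.etaTanh) ≤ 1 / r * (1 / H.collarAngle r) := by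
      have h2 := collarAngle_le h1 hE
      rw [one_div_mul_one_div_rev]
      apply one_div_le_one_div_of_le (by positivity)
      have h3 := mul_le_mul_of_nonneg_right h2 hr0.le
      refine h3.trans ?_
      have h4 : Real.pi / 2 * (H.etaTanh * (r ^ 2 + 1) / (2 * r)) * r =
          Real.pi * H.etaTanh * ((r ^ 2 + 1) / 4) := by field_simp; norm_num
      rw [h4]
      refine mul_le_of_le_one_right (by positivity) ?_
      nlinarith [hr.2]
    refine (ENNReal.ofReal_le_ofReal hle).trans ?_
    rw [ENNReal.ofReal_mul (by positivity)]
    refine mul_le_mul_right ?_ _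
    rw [one_div, ENNReal.ofReal_inv_of_pos hf, ENNReal.inv_le_iff_le_mul]
    · exact key
    · simp [hf]
    · simp
  refine le_trans (le_of_eq ?_) (setLIntegral_mono' measurableSet_Ioo hr)
  rw [setLIntegral_const, Real.volume_Ioo, ← ENNReal.ofReal_mul (by positivity)]
  congr 1
  field_simp
  norm_num

lemma le_modulus (ha : 3 / 2 ≤ Real.exp H.a) : ENNReal.ofReal (1 / (2 * Real.pi * H.etaTanh)) ≤
    H.modulus (H.joiningCurves H.halfCollar H.alpha H.beta) :=
  le_iInf fun _ => le_iInf fun hm => le_iInf fun hρ =>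
    (le_lintegral_sheetDensity_sq ha hm hρ).trans (lintegral_sheetDensity_sq_le hm)

lemma extremalDistance_le (ha : 3 / 2 ≤ Real.exp H.a) :
    H.extremalDistance ≤ ENNReal.ofReal (2 * Real.pi * H.etaTanh) := by
  have hτ := H.etaTanh_pos
  have hπ := Real.pi_pos
  refine (ENNReal.inv_le_inv.2 (le_modulus ha)).trans (le_of_eq ?_)
  rw [← ENNReal.ofReal_inv_of_pos (by positivity), one_div, inv_inv]

variable (H) in
lemma le_extremalDistance :
    ENNReal.ofReal (H.etaTanh / (2 * Real.pi ^ 2)) ≤ H.extremalDistance := by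
  have hτ := H.etaTanh_pos
  have hπ := Real.pi_pos
  refine le_trans (le_of_eq ?_) (ENNReal.inv_le_inv.2 H.modulus_le)
  rw [← ENNReal.ofReal_inv_of_pos (by positivity), inv_div]

end Hexagon

/-! ### Comparison of `etaTanh` with the lengths. -/

lemma half_le_artanh {x : ℝ} (h0 : 0 ≤ x) (h1 : x < 1) : x / 2 ≤ Real.artanh x := by
  have h2 : 0 < 1 - x := by linarith
  rw [Real.artanh_eq_half_log ⟨by linarith, h1.le⟩]
  have h3 := Real.one_sub_inv_le_log_of_pos (x := (1 + x) / (1 - x)) (by positivity)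
  have h4 : x ≤ 1 - ((1 + x) / (1 - x))⁻¹ := by
    rw [inv_div, le_sub_iff_add_le, ← le_sub_iff_add_le', div_le_iff₀ (by positivity)]
    nlinarith
  linarith

/-- From `t ≤ sinh t` at `t = artanh x`, `artanh x ≤ x / √(1 - x²)`; for `x ≤ 12/13` the root is at
least `5/13 > 1/3`. -/
lemma artanh_le_three_mul {x : ℝ} (h0 : 0 ≤ x) (h1 : x ≤ 12 / 13) : Real.artanh x ≤ 3 * x := by
  have h2 := Real.self_le_sinh_iff.2 (Real.artanh_nonneg h0)
  rw [Real.sinh_artanh ⟨by linarith, by linarith⟩] at h2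
  refine h2.trans ?_
  have h3 : 1 / 3 ≤ √(1 - x ^ 2) := Real.le_sqrt_of_sq_le (by nlinarith)
  rw [div_le_iff₀ (by linarith)]
  nlinarith

namespace Hexagon

variable {H : Hexagon}

/-- Combines `etaTanh / (2π²) ≤ λ ≤ 2π etaTanh` with a two-sided comparison of `Y` and `etaTanh`.
The constant `64` covers both `3 * 2π² ≤ 60` and `4 * 2π`. -/
lemma comparable_extremalDistance (ha : 3 / 2 ≤ Real.exp H.a) {Y : ℝ} {y : ℝ≥0∞}
    (hy : y = ENNReal.ofReal Y) (h1 : Y ≤ 3 * H.etaTanh) (h2 : H.etaTanh ≤ 4 * Y) :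
    Comparable 64 H.extremalDistance y := by
  have hτ := H.etaTanh_pos
  have hπ := Real.pi_pos
  have hπ2 := Real.pi_lt_d2
  subst hy
  constructor
  · refine le_trans ?_ H.le_extremalDistance
    rw [← ENNReal.ofReal_mul (by norm_num)]
    apply ENNReal.ofReal_le_ofReal
    rw [le_div_iff₀ (by positivity)]
    have : 2 * Real.pi ^ 2 ≤ 20 := by nlinarith
    nlinarith
  · refine (extremalDistance_le ha).trans ?_
    rw [← ENNReal.ofReal_mul (by norm_num)]
    apply ENNReal.ofReal_le_ofReal
    nlinarith

/-- At `exp a = 3/2` one has `cosh a = (3/2 + 2/3) / 2 = 13/12`. -/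
lemma etaTanh_le (ha : 3 / 2 ≤ Real.exp H.a) : H.etaTanh ≤ 12 / 13 := by
  have h : 13 / 12 ≤ Real.cosh H.a := by
    rw [Real.cosh_eq, Real.exp_neg]
    field_simp
    nlinarith
  rw [etaTanh, div_le_iff₀ (Real.cosh_pos _)]
  linarith [H.gammaTanh_le_one]

variable (H)

lemma etaTanh_le_mul_exp : H.etaTanh ≤ 2 * (H.gammaTanh * Real.exp (-H.a)) := by
  have h := H.gammaTanh_pos
  have h2 : Real.exp H.a * Real.exp (-H.a) = 1 := by rw [← Real.exp_add]; simp
  rw [etaTanh, div_le_iff₀ (Real.cosh_pos _), Real.cosh_eq]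
  nlinarith [mul_pos h (mul_pos (Real.exp_pos (-H.a)) (Real.exp_pos (-H.a)))]

lemma mul_exp_le_etaTanh : H.gammaTanh * Real.exp (-H.a) ≤ H.etaTanh := by
  have h := H.gammaTanh_pos
  have h2 : Real.exp H.a * Real.exp (-H.a) = 1 := by rw [← Real.exp_add]; simp
  have h3 : Real.exp (-H.a) ≤ 1 := Real.exp_le_one_iff.2 (by linarith [H.a_pos])
  rw [etaTanh, le_div_iff₀ (Real.cosh_pos _), Real.cosh_eq]
  have h4 : Real.exp (-H.a) * Real.exp (-H.a) ≤ 1 := by nlinarith [Real.exp_pos (-H.a)]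
  nlinarith [mul_le_mul_of_nonneg_left h4 h.le]

end Hexagon

end HalfCollar

theorem mainTheorem7 :
    ∃ C : ℝ, 1 ≤ C ∧ ∀ H : HalfCollar.Hexagon, 1 < H.alphaLength →
      HalfCollar.extTanh H.etaLength =
          HalfCollar.extTanh H.gammaLength / Real.cosh (H.alphaLength / 2) ∧
        HalfCollar.Comparable C H.extremalDistance H.etaLength ∧
        (1 ≤ H.gammaLength →
          HalfCollar.Comparable C H.extremalDistance
            (ENNReal.ofReal (Real.exp (-H.alphaLength / 2)))) ∧
        (H.gammaLength < 1 →
          HalfCollar.Comparable C H.extremalDistance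
            (H.gammaLength * ENNReal.ofReal (Real.exp (-H.alphaLength / 2)))) := by
  refine ⟨64, by norm_num, fun H hα => ?_⟩
  rw [H.alphaLength_eq] at hα ⊢
  have ea : 2 * H.a / 2 = H.a := by ring
  have ena : -(2 * H.a) / 2 = -H.a := by ring
  rw [ea, ena]
  -- `ℓ(α) > 1` means `a > 1/2`, and `exp a ≥ 1 + a`.
  have ha : 3 / 2 ≤ Real.exp H.a := by linarith [Real.add_one_le_exp H.a]
  have hτ := H.etaTanh_pos
  have hT := H.gammaTanh_pos
  have hexp := Real.exp_pos (-H.a)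
  have hle := H.etaTanh_le_mul_exp
  have hge := H.mul_exp_le_etaTanh
  refine ⟨?_, ?_, fun hγ => ?_, fun hγ => ?_⟩
  · rw [H.extTanh_etaLength, H.extTanh_gammaLength, HalfCollar.Hexagon.etaTanh]
  · refine HalfCollar.Hexagon.comparable_extremalDistance ha H.etaLength_eq
      (HalfCollar.artanh_le_three_mul hτ.le (HalfCollar.Hexagon.etaTanh_le ha)) ?_
    linarith [HalfCollar.half_le_artanh hτ.le H.etaTanh_lt_one]
  -- For `ℓ(γ) ≥ 1`, `gammaTanh` lies in `[1/3, 1]`. The case `gammaTanh > 12/13` needs no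
  -- information on `ℓ(γ)` and includes the puncture.
  · have hT3 : 1 ≤ 3 * H.gammaTanh := by
      rcases le_or_gt H.gammaTanh (12 / 13) with h | h
      · rw [H.gammaLength_eq, if_pos (by linarith), ENNReal.one_le_ofReal] at hγ
        exact hγ.trans (HalfCollar.artanh_le_three_mul hT.le h)
      · linarith
    refine HalfCollar.Hexagon.comparable_extremalDistance ha rfl ?_ ?_
    · nlinarith
    · nlinarith [H.gammaTanh_le_one]
  · rw [H.gammaLength_eq] at hγ ⊢
    split_ifs at hγ ⊢ with h1
    · rw [ENNReal.ofReal_lt_one] at hγ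
      have hℓ : Real.artanh H.gammaTanh ≤ 3 * H.gammaTanh := by
        rcases le_or_gt H.gammaTanh (12 / 13) with h | h
        · exact HalfCollar.artanh_le_three_mul hT.le h
        -- Here `artanh gammaTanh < 1` by hypothesis, while `3 * gammaTanh > 1`.
        · linarith
      have hℓ2 := HalfCollar.half_le_artanh hT.le h1
      refine HalfCollar.Hexagon.comparable_extremalDistance ha
        (ENNReal.ofReal_mul (Real.artanh_nonneg hT.le)).symm ?_ ?_
      · nlinarith
      · nlinarith
    · exact absurd hγ (by simp)
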